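/- Let $n\ge 0$ be an integer and $1\le p<\infty$. For $x\in\mathbb R^n$, $t\in\mathbb R$, $L>0$ let $Q(x,L)=\{y\in\mathbb R^n: |y_i-x_i|\le L/2,\ i=1,\dots,n\}$. The parabolic rectangle $R=R(x,t,L)=Q(x,L)\times(t-L^p,t+L^p)\subset\mathbb R^{n+1}$ has the upper part $R^+=Q(x,L)\times(t,t+L^p)$ and the lower part $R^-=Q(x,L)\times(t-L^p,t)$. Let $|A|$ denote Lebesgue measure, $w(A)=\int_A w$ and $w_A=\frac1{|A|}\int_A w$. For a locally integrable $f$ let \[ M^+f(z)=\sup_{R^-\ni z}\frac1{|R^+|}\int_{R^+}|f| , \] the supremum being over all parabolic rectangles $R$ with $z\in R^-$. A weight is a nonnegative locally integrable function on $\mathbb R^{n+1}$. For $1<q<\infty$, a weight $w$ belongs to $RH^+_q$ if there is a constant $C$ with \[ \Big(\frac1{|R^-|}\int_{R^-}w^q\Big)^{1/q}\le C\,\frac1{|R^+|}\int_{R^+}w \] for every parabolic rectangle $R$. All integrals take values in $[0,\infty]$. Quotients are read with $0/0=0$ and $a/0=\infty$ for $a>0$; $\log^+ a=\max\{0,\log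 a\}$ with $\log^+0=0$, $\log^+\infty=\infty$, and $0\cdot\infty=0$. For $\beta>0$, write $a\prec\beta b$ if $a<\beta b$ or $a=b=0$ (so that $a\prec\beta b$ is just $a<\beta b$ when $b>0$). Theorem. Let $w$ be a weight. The following conditions are equivalent. (i) $w\in RH^+_q$ for some $1<q<\infty$. (ii) There exist constants $C,\delta>0$ such that \[ \frac{w(E)}{w(R^+)}\le C\Big(\frac{|E|}{|R^-|}\Big)^\delta \] for every parabolic rectangle $R$ and every measurable set $E\subset R^-$. (iii) For every $\beta>0$ there exists $0<\alpha<1$ such that for every parabolic rectangle $R$ and every measurable set $E\subset R^-$ with $|E|<\alpha|R^-|$ we have $w(E)\prec\beta\, w(R^+)$. (iv) There exist $0<\alpha<1$ and $0<\beta<1/2^{n+p}$ such that for every parabolic rectangle $R$ and every measurable set $E\subset R^-$ with $|E|<\alpha|R^-|$ we have $w(E)\prec\beta\, w(R^+)$. (v) There exist $0<\alpha<1$ and $0<\beta<1/2^{n+p}$ such that for every parabolic rectangle $R$ we have \[ w\big(R^-\cap\{\alpha w>w_{R^+}\}\big)\prec\beta\, w(R^+). \] (vi) There exists a constant $C$ such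 that \[ \int_{R^-}M^+(w\chi_{R^-})\le C\int_{R^+}w \] for every parabolic rectangle $R$. (vii) There exists a constant $C$ such that \[ \int_{R^-}w\log^+\Big(\frac{w}{w_{R^+}}\Big)\le C\,w(R^+) \] for every parabolic rectangle $R$. -/

import Mathlib

open MeasureTheory Set
open scoped ENNReal NNReal

namespace Parabolic

/-- The space `ℝⁿ⁺¹` of points `(x, t)` with `x ∈ ℝⁿ` and `t ∈ ℝ`; its `volume` is Lebesgue
measure. -/
abbrev SpaceTime (n : ℕ) : Type := (Fin n → ℝ) × ℝ

/-- The closed spatial cube `Q(x, L)` with centre `x` and side length `L`. -/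
def cube {n : ℕ} (x : Fin n → ℝ) (L : ℝ) : Set (Fin n → ℝ) :=
  {y | ∀ i, |y i - x i| ≤ L / 2}

/-- A parabolic rectangle `R(x, t, L)`, given by its centre `(x, t)` and its side length `L > 0`.
For the exponent `p` it is the set `Q(x, L) × (t - L ^ p, t + L ^ p)`. -/
structure Rectangle (n : ℕ) where
  x : Fin n → ℝ
  t : ℝ
  L : ℝ
  L_pos : 0 < L

namespace Rectangle

variable {n : ℕ}

/-- The upper part `R⁺ = Q(x, L) × (t, t + L ^ p)` (zero time lag). -/
def upper (p : ℝ) (R : Rectangle n) : Set (SpaceTime n) :=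
  cube R.x R.L ×ˢ Ioo R.t (R.t + R.L ^ p)

/-- The lower part `R⁻ = Q(x, L) × (t - L ^ p, t)` (zero time lag). -/
def lower (p : ℝ) (R : Rectangle n) : Set (SpaceTime n) :=
  cube R.x R.L ×ˢ Ioo (R.t - R.L ^ p) R.t

end Rectangle

section Weights

variable {n : ℕ}

/-- A weight is a locally integrable nonnegative function on `ℝⁿ⁺¹`. -/
def IsWeight (w : SpaceTime n → ℝ) : Prop :=
  LocallyIntegrable w volume ∧ ∀ z, 0 ≤ w z

/-- `w(A) = ∫_A w`. -/
noncomputable def mass (w : SpaceTime n → ℝ) (A : Set (SpaceTime n)) : ℝ≥0∞ :=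
  ∫⁻ z in A, ENNReal.ofReal (w z)

/-- The integral average `w_A = |A|⁻¹ ∫_A w`. -/
noncomputable def avg (w : SpaceTime n → ℝ) (A : Set (SpaceTime n)) : ℝ≥0∞ :=
  ⨍⁻ z in A, ENNReal.ofReal (w z) ∂volume

/-- The uncentred forward in time parabolic maximal function
`M⁺ f (z) = sup_{R⁻ ∋ z} |R⁺|⁻¹ ∫_{R⁺} |f|`. -/
noncomputable def maximalPlus (p : ℝ) (f : SpaceTime n → ℝ) (z : SpaceTime n) : ℝ≥0∞ :=
  ⨆ (R : Rectangle n) (_ : z ∈ R.lower p), avg (fun y => |f y|) (R.upper p)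

/-- The parabolic reverse Hölder class `RH⁺_q`:
`(|R⁻|⁻¹ ∫_{R⁻} w ^ q) ^ (1 / q) ≤ C |R⁺|⁻¹ ∫_{R⁺} w` for all parabolic rectangles `R`. -/
def MemRHPlus (p q : ℝ) (w : SpaceTime n → ℝ) : Prop :=
  ∃ C : ℝ≥0, ∀ R : Rectangle n,
    (⨍⁻ z in R.lower p, ENNReal.ofReal (w z) ^ q ∂volume) ^ (1 / q) ≤ C * avg w (R.upper p)

end Weights

/-- `log⁺ a = max (0, log a)` for `a ∈ [0, ∞]`, with `log⁺ 0 = 0` and `log⁺ ∞ = ∞`. -/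
noncomputable def logPlus (a : ℝ≥0∞) : ℝ≥0∞ := (ENNReal.log a).toENNReal

/-- The strict inequality `a < β b`, except that the degenerate case `a = b = 0` is admitted;
for `b > 0` it is the plain inequality `a < β b`. -/
def StrictBound (a : ℝ≥0∞) (β : ℝ) (b : ℝ≥0∞) : Prop :=
  a < ENNReal.ofReal β * b ∨ (a = 0 ∧ b = 0)

end Parabolic

/-!
The conditions are tied together by the implications (i) → (ii) → (iii) → (iv) → (v) → (i),
(i) → (vi) → (v) and (i) → (vii) → (v). Everything is expressed through the measure `μ = w dx`,
represented by a measurable density `f` that agrees with `w` almost everywhere. Write `|R|` for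
the common volume `L ^ (n + p)` of `R⁺` and `R⁻`.

*From (v) to a reverse Hölder inequality.* Condition (v) gives the forward doubling
`μ(R⁻) ≤ D μ(R⁺)`. Fix a rectangle `R` and a level `lam` above the average over `R⁺`. For a point
`z` with `f z > K lam` let `A z s` be the box of side length `s` in the future of `z`, and stop at
the largest scale, up to a factor `2`, at which its average exceeds `lam`. As `p ≥ 1`, the box
`A z (2 s)` contains both `A z s` and the next box in time, so the next box has average at
most `2 ^ (n + p) lam`; since `β 2 ^ (n + p) < 1`, condition (v) leaves a fixed proportion of the
mass of `A z s` at levels between `lam / K` and `K lam`. A Vitali type selection of disjoint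
stopping boxes, for which the engulfing boxes are controlled by forward doubling, yields
`μ {f > K lam} ≤ C μ {lam / K < f ≤ K lam}` (`measure_superlevel_le_measure_band`). This says that
`μ {f > K lam} ≤ ρ μ {f > lam / K}` with `ρ < 1`. The stopping boxes reach beyond `R⁻`, but
only by their own size, which decreases geometrically with the level, so the estimate can be
iterated (`exists_geometric_decay`) and summed (`exists_reverseHolder_of_decay`).

Two choices make the geometry elementary. The spatial cubes are pushed inside the cube of `R`
(`innerCenter`), so nothing leaves that cube sideways. The points without a stopping scale are shown
to be a null set by the same covering lemma and outer regularity
(`volume_eq_zero_of_measure_le_isOpen`), so that no differentiation theorem for parabolic boxes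
is needed.

*The maximal function.* The weak type estimate with the mass restricted to a superlevel set
(`mul_volume_forwardMaximal_le`), summed over dyadic levels, gives (i) → (vi). Conversely, a
stopping argument with boxes around `z` shows that `lam |{M⁺ ≥ c lam}|` controls the mass of
`{f > K lam}` (`exists_forwardMaximal_ge`); a sum over `m` dyadic levels improves this by a factor `1 / m`, which
gives (vi) → (v) with an arbitrarily small constant.

*The remaining implications* are Hölder's and Chebyshev's inequalities, and for (iv) → (v) also a
slicing of `R⁻` in time.
-/

namespace Parabolic

/-! ### Volumes and cubes -/

/-- The volume `L ^ (n + p)` of either half of a parabolic rectangle of side length `L`. -/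
noncomputable def halfVolume (n : ℕ) (p s : ℝ) : ℝ≥0∞ := ENNReal.ofReal (s ^ ((n : ℝ) + p))

section Geometry

variable {n : ℕ} {p : ℝ}

theorem cube_eq_closedBall (x : Fin n → ℝ) {L : ℝ} (hL : 0 ≤ L) :
    cube x L = Metric.closedBall x (L / 2) := by
  ext y
  rw [Metric.mem_closedBall, dist_pi_le_iff (by positivity)]
  rfl

theorem measurableSet_cube (x : Fin n → ℝ) (L : ℝ) : MeasurableSet (cube x L) := by
  have : cube x L = ⋂ i, {y | |y i - x i| ≤ L / 2} := by ext y; simp [cube]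
  rw [this]
  refine MeasurableSet.iInter fun i => measurableSet_le ?_ measurable_const
  fun_prop

theorem measurableSet_box (x : Fin n → ℝ) (L a b : ℝ) :
    MeasurableSet (cube x L ×ˢ Ioo a b : Set (SpaceTime n)) :=
  (measurableSet_cube x L).prod measurableSet_Ioo

theorem measurableSet_lower (R : Rectangle n) : MeasurableSet (R.lower p) :=
  measurableSet_box _ _ _ _

theorem measurableSet_upper (R : Rectangle n) : MeasurableSet (R.upper p) :=
  measurableSet_box _ _ _ _

theorem volume_box (x : Fin n → ℝ) {L : ℝ} (hL : 0 ≤ L) (a b : ℝ) :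
    volume (cube x L ×ˢ Ioo a b : Set (SpaceTime n))
      = ENNReal.ofReal (L ^ n) * ENNReal.ofReal (b - a) := by
  rw [Measure.volume_eq_prod, Measure.prod_prod, cube_eq_closedBall x hL,
    Real.volume_pi_closedBall x (by positivity), Real.volume_Ioo, Fintype.card_fin]
  congr 3
  ring

theorem halfVolume_eq {s : ℝ} (hs : 0 < s) :
    halfVolume n p s = ENNReal.ofReal (s ^ n) * ENNReal.ofReal (s ^ p) := by
  rw [halfVolume, Real.rpow_add hs, Real.rpow_natCast, ENNReal.ofReal_mul (by positivity)]

theorem halfVolume_mul {s t : ℝ} (hs : 0 ≤ s) (ht : 0 ≤ t) :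
    halfVolume n p (s * t) = halfVolume n p s * halfVolume n p t := by
  rw [halfVolume, Real.mul_rpow hs ht, ENNReal.ofReal_mul (by positivity)]
  rfl

theorem halfVolume_pos {s : ℝ} (hs : 0 < s) : 0 < halfVolume n p s := by
  rw [halfVolume, ENNReal.ofReal_pos]
  positivity

theorem halfVolume_ne_top (s : ℝ) : halfVolume n p s ≠ ∞ := ENNReal.ofReal_ne_top

theorem halfVolume_mono (hp : 1 ≤ p) {s t : ℝ} (hs : 0 ≤ s) (hst : s ≤ t) :
    halfVolume n p s ≤ halfVolume n p t := by
  unfold halfVolume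
  gcongr

theorem volume_box_rpow (x : Fin n → ℝ) {L : ℝ} (hL : 0 < L) (a : ℝ) :
    volume (cube x L ×ˢ Ioo a (a + L ^ p) : Set (SpaceTime n)) = halfVolume n p L := by
  rw [volume_box x hL.le, halfVolume_eq hL, add_sub_cancel_left]

theorem volume_upper (R : Rectangle n) : volume (R.upper p) = halfVolume n p R.L :=
  volume_box_rpow _ R.L_pos _

theorem volume_lower (R : Rectangle n) : volume (R.lower p) = halfVolume n p R.L := by
  have := volume_box_rpow (p := p) R.x R.L_pos (R.t - R.L ^ p)
  rwa [sub_add_cancel] at this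

/-- The centre of the cube of side length `s` inside the cube of centre `x₀` and side length `L₀`
that is as close as possible to being centred at `x`. -/
noncomputable def innerCenter (x₀ : Fin n → ℝ) (L₀ : ℝ) (x : Fin n → ℝ) (s : ℝ) : Fin n → ℝ :=
  fun i => max (x₀ i - L₀ / 2 + s / 2) (min (x i) (x₀ i + L₀ / 2 - s / 2))

variable {x₀ x y : Fin n → ℝ} {L₀ s s' : ℝ}

theorem innerCube_subset (h : s ≤ L₀) : cube (innerCenter x₀ L₀ x s) s ⊆ cube x₀ L₀ := by
  intro y hy i
  have := hy i
  simp only [innerCenter] at this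
  grind

theorem innerCube_mono (h : s ≤ s') :
    cube (innerCenter x₀ L₀ x s) s ⊆ cube (innerCenter x₀ L₀ x s') s' := by
  intro y hy i
  have := hy i
  simp only [innerCenter] at this ⊢
  grind

/-- An inner cube contains all points of the ambient cube within distance `s / 2` of `x`. -/
theorem mem_innerCube (hy : y ∈ cube x₀ L₀) (h : ∀ i, |y i - x i| ≤ s / 2) :
    y ∈ cube (innerCenter x₀ L₀ x s) s := by
  intro i
  have h1 := hy i
  have h2 := h i
  simp only [innerCenter]
  grind

theorem abs_sub_le_of_mem_innerCube (hs : 0 ≤ s) (hx : x ∈ cube x₀ L₀)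
    (hy : y ∈ cube (innerCenter x₀ L₀ x s) s) (i : Fin n) : |y i - x i| ≤ s := by
  have h1 : x ∈ cube (innerCenter x₀ L₀ x s) s :=
    mem_innerCube hx fun i => by rw [sub_self, abs_zero]; linarith
  have h2 := h1 i
  have h3 := hy i
  grind

theorem rpow_add_rpow_le_rpow_add (hp : 1 ≤ p) {a b : ℝ} (ha : 0 ≤ a) (hb : 0 ≤ b) :
    a ^ p + b ^ p ≤ (a + b) ^ p := by
  lift a to ℝ≥0 using ha
  lift b to ℝ≥0 using hb
  exact_mod_cast NNReal.add_rpow_le_rpow_add a b hp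

theorem exists_pos_box_subset_of_isOpen {O : Set (SpaceTime n)} (hO : IsOpen O)
    {z : SpaceTime n} (hz : z ∈ O) :
    ∃ ε : ℝ, 0 < ε ∧ ∀ y : SpaceTime n, (∀ i, |y.1 i - z.1 i| ≤ ε) → |y.2 - z.2| ≤ ε → y ∈ O := by
  obtain ⟨ε, hε, h⟩ := Metric.nhds_basis_closedBall.mem_iff.1 (hO.mem_nhds hz)
  refine ⟨ε, hε, fun y h1 h2 => h ?_⟩
  rw [Metric.mem_closedBall, Prod.dist_eq, max_le_iff, dist_pi_le_iff hε.le]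
  exact ⟨h1, h2⟩

end Geometry

/-! ### Covering lemmas -/

section Covering

variable {n : ℕ}

/-- A Vitali covering lemma without a metric: if `V' z'` contains every `z` for which `V z` meets
`V z'` at comparable scale, and `μ (V' z) ≤ c |V z|`, then `E` has `μ`-measure at most `c` times
the volume of a disjoint subfamily of the sets `V z`. -/
theorem exists_disjoint_subfamily_measure_le (μ : Measure (SpaceTime n)) {E : Set (SpaceTime n)}
    {V V' : SpaceTime n → Set (SpaceTime n)} {s : SpaceTime n → ℝ} {Λ : ℝ} {c : ℝ≥0∞}
    (hs : ∀ z ∈ E, 0 < s z ∧ s z ≤ Λ) (hV : ∀ z ∈ E, MeasurableSet (V z))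
    (hVpos : ∀ z ∈ E, 0 < volume (V z))
    (hcover : ∀ z ∈ E, ∀ z' ∈ E, s z ≤ 2 * s z' → (V z ∩ V z').Nonempty → z ∈ V' z')
    (hμ : ∀ z ∈ E, μ (V' z) ≤ c * volume (V z)) :
    ∃ J ⊆ E, J.Countable ∧ J.PairwiseDisjoint V ∧ μ E ≤ c * volume (⋃ z ∈ J, V z) := by
  obtain ⟨J, hJE, hJd, hJ⟩ := Vitali.exists_disjoint_subfamily_covering_enlargement V E s 2
    one_lt_two (fun z hz => (hs z hz).1.le) Λ (fun z hz => (hs z hz).2)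
    (fun z hz => nonempty_of_measure_ne_zero (hVpos z hz).ne')
  have hJc : J.Countable := by
    have := Measure.countable_meas_pos_of_disjoint_iUnion (μ := (volume : Measure (SpaceTime n)))
      (As := fun z : J => V z) (fun z => hV z (hJE z.2))
      (fun a b hab => hJd a.2 b.2 (fun h => hab (Subtype.ext h)))
    have h2 : {i : J | 0 < volume (V i)} = univ :=
      eq_univ_of_forall fun i => hVpos i (hJE i.2)
    rw [h2] at this
    exact Set.countable_coe_iff.1 (Set.countable_univ_iff.1 this)
  refine ⟨J, hJE, hJc, hJd, ?_⟩
  have hsub : E ⊆ ⋃ z ∈ J, V' z := by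
    intro z hz
    obtain ⟨z', hz', hne, hle⟩ := hJ z hz
    exact mem_biUnion hz' (hcover z hz z' (hJE hz') hle hne)
  calc μ E ≤ μ (⋃ z ∈ J, V' z) := measure_mono hsub
    _ ≤ ∑' z : J, μ (V' z) := measure_biUnion_le μ hJc V'
    _ ≤ ∑' z : J, c * volume (V z) := ENNReal.tsum_le_tsum fun z => hμ z (hJE z.2)
    _ = c * volume (⋃ z ∈ J, V z) := by
      rw [ENNReal.tsum_mul_left, measure_biUnion hJc hJd (fun z hz => hV z (hJE hz))]

/-- A set of finite volume on which the density exceeds `κ`, while every open superset `O` bounds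
the mass by `c |O|` with `c < κ`, is a null set. This replaces Lebesgue differentiation. -/
theorem volume_eq_zero_of_measure_le_isOpen {f : SpaceTime n → ℝ≥0∞} (hf : Measurable f)
    {E : Set (SpaceTime n)} {c κ : ℝ≥0∞} (hcκ : c < κ) (hfin : volume E ≠ ∞)
    (hE : ∀ z ∈ E, κ < f z)
    (h : ∀ O, IsOpen O → E ⊆ O → volume.withDensity f E ≤ c * volume O) : volume E = 0 := by
  have hc : c ≠ ∞ := hcκ.ne_top
  have h1 : volume.withDensity f E ≤ c * volume E := by
    refine ENNReal.le_of_forall_pos_le_add fun ε hε _ => ?_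
    obtain ⟨O, hEO, hO, hOle⟩ := E.exists_isOpen_le_add volume (ε := ε / (c + 1)) (by
      simp [hε.ne', hc])
    calc volume.withDensity f E ≤ c * volume O := h O hO hEO
      _ ≤ c * (volume E + ε / (c + 1)) := by gcongr
      _ = c * volume E + c / (c + 1) * ε := by
        rw [mul_add, ENNReal.div_eq_inv_mul, ENNReal.div_eq_inv_mul]; ring
      _ ≤ c * volume E + 1 * ε := by
        gcongr
        exact ENNReal.div_le_of_le_mul (by rw [one_mul]; exact le_self_add)
      _ = _ := by rw [one_mul]
  have h2 : κ * volume E ≤ volume.withDensity f E := by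
    rw [withDensity_apply' f E, ← setLIntegral_const]
    refine lintegral_mono_ae ?_
    have hG : MeasurableSet {z | κ < f z} := measurableSet_lt measurable_const hf
    have := ae_restrict_mem (μ := volume) hG
    filter_upwards [ae_restrict_of_ae_restrict_of_subset (show E ⊆ {z | κ < f z} from hE) this]
      with z hz using le_of_lt hz
  by_contra h0
  exact absurd (h2.trans h1) (not_le.2 (ENNReal.mul_lt_mul_left h0 hfin hcκ))

end Covering

/-! ### The stopping argument -/

section Stopping

variable {n : ℕ} {p : ℝ}

/-- Let `A z s` be sets attached to the points `z ∈ H` and the scales `s`. At every point the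
stopping scale is, up to a factor `2`, the largest scale at which the mass of `A z s` exceeds
`lam` times the reference volume. The points without such a scale form a null set, and the others
are controlled by a disjoint family of sets `V z (s z)` at stopping scales. -/
theorem exists_stopping_family {f : SpaceTime n → ℝ≥0∞} (hf : Measurable f)
    {H : Set (SpaceTime n)} {A V V' : SpaceTime n → ℝ → Set (SpaceTime n)} {Λ : ℝ} (hΛ : 0 < Λ)
    {lam c κ : ℝ≥0∞} (hcκ : c < κ) (hfin : volume H ≠ ∞) (hH : ∀ z ∈ H, κ < f z)
    (hV : ∀ z s, MeasurableSet (V z s)) (hVpos : ∀ z s, 0 < s → 0 < volume (V z s))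
    (hsmall : ∀ z ∈ H, ∀ O, IsOpen O → z ∈ O → ∃ ε : ℝ, 0 < ε ∧
      ∀ s, 0 < s → s ≤ ε → V z s ⊆ O)
    (hcover : ∀ z ∈ H, ∀ z' ∈ H, ∀ s s', 0 < s → 0 < s' → s ≤ 2 * s' →
      (V z s ∩ V z' s').Nonempty → z ∈ V' z' s')
    (hmass : ∀ z ∈ H, ∀ s, 0 < s → s ≤ Λ →
      (∀ s', 2 * s ≤ s' → s' ≤ 16 * Λ → volume.withDensity f (A z s') ≤ lam * halfVolume n p s') →
      volume.withDensity f (V' z s) ≤ c * volume (V z s))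
    (htop : ∀ z ∈ H, ∀ s, Λ ≤ s → s ≤ 16 * Λ →
      volume.withDensity f (A z s) ≤ lam * halfVolume n p s) :
    ∃ J ⊆ H, ∃ s : SpaceTime n → ℝ, J.Countable ∧ J.PairwiseDisjoint (fun z => V z (s z)) ∧
      (∀ z ∈ J, 0 < s z ∧ s z ≤ Λ ∧ lam * halfVolume n p (s z) < volume.withDensity f (A z (s z)) ∧
        ∀ s', 2 * s z ≤ s' → s' ≤ 16 * Λ →
          volume.withDensity f (A z s') ≤ lam * halfVolume n p s') ∧
      volume.withDensity f H ≤ c * volume (⋃ z ∈ J, V z (s z)) := by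
  set μ := volume.withDensity f
  let S : SpaceTime n → Set ℝ := fun z => {s | 0 < s ∧ s ≤ Λ ∧ lam * halfVolume n p s < μ (A z s)}
  have hSle : ∀ z ∈ H, ∀ s, (∀ t ∈ S z, t < s) → 0 < s → s ≤ 16 * Λ →
      μ (A z s) ≤ lam * halfVolume n p s := by
    intro z hz s h hs hs16
    rcases le_total Λ s with h1 | h1
    · exact htop z hz s h1 hs16
    · by_contra hlt
      exact lt_irrefl _ (h s ⟨hs, h1, not_le.1 hlt⟩)
  have hex : ∀ z, (S z).Nonempty → ∃ s ∈ S z, ∀ t ∈ S z, t < 2 * s := by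
    rintro z ⟨s₁, hs₁⟩
    have hb : BddAbove (S z) := ⟨Λ, fun s hs => hs.2.1⟩
    have hpos : 0 < sSup (S z) := hs₁.1.trans_le (le_csSup hb hs₁)
    obtain ⟨s, hs, hlt⟩ := exists_lt_of_lt_csSup ⟨s₁, hs₁⟩ (half_lt_self hpos)
    exact ⟨s, hs, fun t ht => (le_csSup hb ht).trans_lt (by linarith)⟩
  choose! σ hσS hσ using hex
  -- the points at which every average is at most `lam` form a null set
  have hnull : volume {z ∈ H | ¬ (S z).Nonempty} = 0 := by
    refine volume_eq_zero_of_measure_le_isOpen hf hcκ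
      (ne_top_of_le_ne_top hfin (measure_mono (sep_subset _ _))) (fun z hz => hH z hz.1) ?_
    intro O hO hEO
    have : ∀ z, z ∈ {z ∈ H | ¬ (S z).Nonempty} → ∃ ε : ℝ, 0 < ε ∧ ε ≤ Λ ∧ V z ε ⊆ O := by
      intro z hz
      obtain ⟨ε, hε, h⟩ := hsmall z hz.1 O hO (hEO hz)
      exact ⟨min ε Λ, lt_min hε hΛ, min_le_right _ _, h _ (lt_min hε hΛ) (min_le_left _ _)⟩
    choose! ε hε hεΛ hεO using this
    obtain ⟨J, hJE, -, -, hJ⟩ := exists_disjoint_subfamily_measure_le μ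
      (V := fun z => V z (ε z)) (V' := fun z => V' z (ε z)) (s := ε) (Λ := Λ) (c := c)
      (fun z hz => ⟨hε z hz, hεΛ z hz⟩) (fun z _ => hV _ _) (fun z hz => hVpos _ _ (hε z hz))
      (fun z hz z' hz' hle hne => hcover z hz.1 z' hz'.1 _ _ (hε z hz) (hε z' hz') hle hne)
      (fun z hz => hmass z hz.1 _ (hε z hz) (hεΛ z hz) fun s' h1 h2 =>
        hSle z hz.1 s' (fun t ht => absurd ⟨t, ht⟩ hz.2) (by linarith [hε z hz]) h2)
    refine hJ.trans ?_
    gcongr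
    exact iUnion₂_subset fun z hz => hεO z (hJE hz)
  have hceil : ∀ z ∈ {z ∈ H | (S z).Nonempty}, ∀ s', 2 * σ z ≤ s' → s' ≤ 16 * Λ →
      μ (A z s') ≤ lam * halfVolume n p s' := fun z hz s' h1 h2 =>
    hSle z hz.1 s' (fun t ht => (hσ z hz.2 t ht).trans_le h1)
      (by linarith [(hσS z hz.2).1]) h2
  obtain ⟨J, hJE, hJc, hJd, hJ⟩ := exists_disjoint_subfamily_measure_le μ
    (E := {z ∈ H | (S z).Nonempty})
    (V := fun z => V z (σ z)) (V' := fun z => V' z (σ z)) (s := σ) (Λ := Λ) (c := c)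
    (fun z hz => ⟨(hσS z hz.2).1, (hσS z hz.2).2.1⟩) (fun z _ => hV _ _)
    (fun z hz => hVpos _ _ (hσS z hz.2).1)
    (fun z hz z' hz' hle hne => hcover z hz.1 z' hz'.1 _ _ (hσS z hz.2).1 (hσS z' hz'.2).1 hle hne)
    (fun z hz => hmass z hz.1 _ (hσS z hz.2).1 (hσS z hz.2).2.1 (hceil z hz))
  refine ⟨J, fun z hz => (hJE hz).1, σ, hJc, hJd, fun z hz =>
    ⟨(hσS z (hJE hz).2).1, (hσS z (hJE hz).2).2.1, (hσS z (hJE hz).2).2.2, hceil z (hJE hz)⟩, ?_⟩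
  calc μ H ≤ μ ({z ∈ H | (S z).Nonempty} ∪ {z ∈ H | ¬ (S z).Nonempty}) :=
        measure_mono fun z hz => by
          by_cases h : (S z).Nonempty
          · exact Or.inl ⟨hz, h⟩
          · exact Or.inr ⟨hz, h⟩
    _ ≤ μ {z ∈ H | (S z).Nonempty} + μ {z ∈ H | ¬ (S z).Nonempty} := measure_union_le _ _
    _ = μ {z ∈ H | (S z).Nonempty} := by
        rw [withDensity_absolutelyContinuous volume f hnull, add_zero]
    _ ≤ _ := hJ

end Stopping

/-! ### Mass at levels comparable to the average -/

section Forward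

variable {n : ℕ} {p : ℝ}

/-- The box of side length `s` lying in the future of `z`, with its spatial cube pushed inside the
cube of centre `x₀` and side length `L₀`. -/
def futureBox (x₀ : Fin n → ℝ) (L₀ p : ℝ) (z : SpaceTime n) (s : ℝ) : Set (SpaceTime n) :=
  cube (innerCenter x₀ L₀ z.1 s) s ×ˢ Ioo z.2 (z.2 + s ^ p)

theorem measure_box_le_add (f : SpaceTime n → ℝ≥0∞) (x : Fin n → ℝ) (L a b c : ℝ) :
    volume.withDensity f (cube x L ×ˢ Ioo a c)
      ≤ volume.withDensity f (cube x L ×ˢ Ioo a b)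
        + volume.withDensity f (cube x L ×ˢ Ioo b c) := by
  have h0 : volume.withDensity f (cube x L ×ˢ {b}) = 0 := by
    refine withDensity_absolutelyContinuous volume f ?_
    rw [Measure.volume_eq_prod, Measure.prod_prod, Real.volume_singleton, mul_zero]
  calc volume.withDensity f (cube x L ×ˢ Ioo a c)
      ≤ volume.withDensity f ((cube x L ×ˢ Ioo a b ∪ cube x L ×ˢ Ioo b c) ∪ cube x L ×ˢ {b}) := by
        refine measure_mono fun z hz => ?_
        rcases lt_trichotomy z.2 b with h | h | h
        · exact Or.inl (Or.inl ⟨hz.1, hz.2.1, h⟩)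
        · exact Or.inr ⟨hz.1, h⟩
        · exact Or.inl (Or.inr ⟨hz.1, h, hz.2.2⟩)
    _ ≤ _ := (measure_union_le _ _).trans (by rw [h0, add_zero]; exact measure_union_le _ _)

theorem measure_inter_le_mul_volume {f : SpaceTime n → ℝ≥0∞} (hf : Measurable f)
    {A : Set (SpaceTime n)} (hA : MeasurableSet A) (t : ℝ≥0∞) :
    volume.withDensity f (A ∩ {z | f z ≤ t}) ≤ t * volume A := by
  have hm : MeasurableSet (A ∩ {z | f z ≤ t}) := hA.inter (measurableSet_le hf measurable_const)
  calc volume.withDensity f (A ∩ {z | f z ≤ t}) = ∫⁻ z in A ∩ {z | f z ≤ t}, f z :=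
        withDensity_apply f hm
    _ ≤ ∫⁻ _ in A ∩ {z | f z ≤ t}, t := setLIntegral_mono' hm fun z hz => hz.2
    _ = t * volume (A ∩ {z | f z ≤ t}) := setLIntegral_const _ _
    _ ≤ t * volume A := by gcongr; exact inter_subset_left

theorem futureBox_subset (hp : 1 ≤ p) {x₀ : Fin n → ℝ} {L₀ a b c s : ℝ} {z : SpaceTime n}
    (hz : z ∈ cube x₀ L₀ ×ˢ Ioo a b) (hs : 0 ≤ s) {r : ℝ} (hr : s ≤ r) (hL : r ≤ L₀)
    (hc : b + r ^ p ≤ c) : futureBox x₀ L₀ p z s ⊆ cube x₀ L₀ ×ˢ Ioo a c := by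
  have hsr : s ^ p ≤ r ^ p := Real.rpow_le_rpow hs hr (by linarith)
  rintro y ⟨hy1, hy2, hy3⟩
  exact ⟨innerCube_subset (hr.trans hL) hy1, hz.2.1.trans hy2, by linarith [hz.2.2]⟩

/-- The stopping argument behind the reverse Hölder inequality. At a stopping scale the box `A z s`
has average above `lam`, while the next box in time has average at most `2 ^ (n + p) lam`, so
that the hypothesis leaves a fixed proportion of the mass of `A z s` at levels comparable
to `lam`. -/
theorem measure_superlevel_le_measure_band (hp : 1 ≤ p) {f : SpaceTime n → ℝ≥0∞}
    (hf : Measurable f) {D a b c K lam : ℝ≥0∞}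
    (hD : ∀ R : Rectangle n,
      volume.withDensity f (R.lower p) ≤ D * volume.withDensity f (R.upper p))
    (hβ : ∀ (R : Rectangle n) (t : ℝ≥0∞),
      volume.withDensity f (R.upper p) ≤ t * halfVolume n p R.L →
      volume.withDensity f (R.lower p ∩ {z | a * t < f z}) ≤ b * t * halfVolume n p R.L)
    (haK : a * halfVolume n p 2 ≤ K) (hDK : (1 + D) * halfVolume n p 8 < K)
    (hc : b * halfVolume n p 2 + K⁻¹ + c ≤ 1)
    (hlam0 : lam ≠ 0) (hlam : lam ≠ ∞) {x₀ : Fin n → ℝ} {L₀ Λ t₁ t₂ t₃ : ℝ} (hΛ : 0 < Λ)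
    (hΛL : 16 * Λ ≤ L₀) (ht : t₂ + (16 * Λ) ^ p ≤ t₃)
    (htot : volume.withDensity f (cube x₀ L₀ ×ˢ Ioo t₁ t₃) ≤ lam * halfVolume n p Λ) :
    c * volume.withDensity f (cube x₀ L₀ ×ˢ Ioo t₁ t₂ ∩ {z | K * lam < f z})
      ≤ (1 + D) * halfVolume n p 8 * volume.withDensity f
        (cube x₀ L₀ ×ˢ Ioo t₁ t₃ ∩ {z | K⁻¹ * lam < f z ∧ f z ≤ K * lam}) := by
  have hp0 : 0 < p := by linarith
  set μ := volume.withDensity f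
  set C := (1 + D) * halfVolume n p 8
  set A := futureBox x₀ L₀ p
  have hAm : ∀ z s, MeasurableSet (A z s) := fun z s => measurableSet_box _ _ _ _
  have hAvol : ∀ z s, 0 < s → volume (A z s) = halfVolume n p s := fun z s hs =>
    volume_box_rpow _ hs _
  set H := cube x₀ L₀ ×ˢ Ioo t₁ t₂ ∩ {z | K * lam < f z}
  have hHfin : volume H ≠ ∞ := by
    refine ne_top_of_le_ne_top ?_ (measure_mono inter_subset_left)
    rw [volume_box x₀ (by linarith)]
    exact ENNReal.mul_ne_top ENNReal.ofReal_ne_top ENNReal.ofReal_ne_top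
  have hAbox : ∀ z ∈ H, ∀ s, 0 < s → s ≤ 16 * Λ → A z s ⊆ cube x₀ L₀ ×ˢ Ioo t₁ t₃ :=
    fun z hz s hs hs' => futureBox_subset hp hz.1 hs.le hs' hΛL ht
  obtain ⟨J, hJH, s, hJc, hJd, hJs, hJ⟩ := exists_stopping_family (p := p) hf (H := H) (A := A)
    (V := A) (V' := fun z s => cube (innerCenter x₀ L₀ z.1 (8 * s)) (8 * s) ×ˢ
      Ioo (z.2 - (8 * s) ^ p) (z.2 + (8 * s) ^ p)) (lam := lam) (c := C * lam) (κ := K * lam)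
    hΛ (ENNReal.mul_lt_mul_left hlam0 hlam hDK) hHfin (fun z hz => hz.2) hAm
    (fun z s hs => by rw [hAvol z s hs]; exact halfVolume_pos hs)
    (by
      intro z hz O hO hzO
      obtain ⟨ε, hε, h⟩ := exists_pos_box_subset_of_isOpen hO hzO
      refine ⟨min ε 1, lt_min hε one_pos, fun s hs hsε y hy => ?_⟩
      have hs1 : s ≤ ε := hsε.trans (min_le_left _ _)
      have hsp : s ^ p ≤ s := by
        simpa using Real.rpow_le_rpow_of_exponent_ge hs (hsε.trans (min_le_right _ _)) hp
      refine h y (fun i => (abs_sub_le_of_mem_innerCube hs.le hz.1.1 hy.1 i).trans hs1) ?_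
      rw [abs_le]
      constructor <;> linarith [hy.2.1, hy.2.2])
    (by
      rintro z hz z' hz' s s' hs hs' hss ⟨y, hy, hy'⟩
      have h8 : (2 * s') ^ p ≤ (8 * s') ^ p :=
        Real.rpow_le_rpow (by positivity) (by linarith) hp0.le
      have h8' : s' ^ p ≤ (8 * s') ^ p := Real.rpow_le_rpow hs'.le (by linarith) hp0.le
      have h8'' : s ^ p ≤ (2 * s') ^ p := Real.rpow_le_rpow hs.le hss hp0.le
      refine ⟨mem_innerCube hz.1.1 fun i => ?_, ?_, ?_⟩
      · have h1 := abs_le.1 (abs_sub_le_of_mem_innerCube hs.le hz.1.1 hy.1 i)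
        have h2 := abs_le.1 (abs_sub_le_of_mem_innerCube hs'.le hz'.1.1 hy'.1 i)
        rw [abs_le]
        constructor <;> linarith
      · linarith [hy.2.2, hy'.2.1]
      · linarith [hy.2.1, hy'.2.2])
    (by
      intro z hz s hs hsΛ hbd
      have h1 := hbd (8 * s) (by linarith) (by linarith)
      let T : Rectangle n := ⟨innerCenter x₀ L₀ z.1 (8 * s), z.2, 8 * s, by linarith⟩
      have hTu : μ (T.upper p) ≤ lam * halfVolume n p (8 * s) := h1
      calc μ _ ≤ μ (T.lower p) + μ (T.upper p) := measure_box_le_add f _ _ _ _ _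
        _ ≤ D * μ (T.upper p) + μ (T.upper p) := by gcongr; exact hD T
        _ = (1 + D) * μ (T.upper p) := by ring
        _ ≤ (1 + D) * (lam * halfVolume n p (8 * s)) := by gcongr
        _ = C * lam * volume (A z s) := by
          rw [hAvol z s hs, halfVolume_mul (by norm_num) hs.le]; ring)
    (fun z hz s hs hs' => (measure_mono (hAbox z hz s (by linarith) hs')).trans
      (htot.trans (by gcongr; exact halfVolume_mono hp hΛ.le hs)))
  set B := {z | K⁻¹ * lam < f z ∧ f z ≤ K * lam}
  have hBm : MeasurableSet B :=
    (measurableSet_lt measurable_const hf).inter (measurableSet_le hf measurable_const)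
  -- on a stopping box the levels outside the band carry at most the proportion `1 - c` of `lam |A|`
  have key : ∀ z ∈ J, c * (lam * volume (A z (s z))) ≤ μ (A z (s z) ∩ B) := by
    intro z hz
    obtain ⟨hs0, hsΛ, hlt, hbd⟩ := hJs z hz
    rw [hAvol z _ hs0]
    set X := lam * halfVolume n p (s z)
    have hXfin : X ≠ ∞ := ENNReal.mul_ne_top hlam (halfVolume_ne_top _)
    let R : Rectangle n := ⟨innerCenter x₀ L₀ z.1 (s z), z.2 + s z ^ p, s z, hs0⟩
    have hRl : R.lower p = A z (s z) := by
      simp only [Rectangle.lower, R, add_sub_cancel_right]; rfl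
    -- the next box in time lies in the box of twice the side length, which no longer stops
    have hRu : μ (R.upper p) ≤ lam * halfVolume n p 2 * halfVolume n p (s z) := by
      have h2s := hbd (2 * s z) le_rfl (by linarith)
      rw [halfVolume_mul (by norm_num) hs0.le, ← mul_assoc] at h2s
      refine (measure_mono ?_).trans h2s
      have h3 := rpow_add_rpow_le_rpow_add hp hs0.le hs0.le
      rw [← two_mul (s z)] at h3
      have h4 : 0 < s z ^ p := by positivity
      rintro y ⟨hy1, hy2, hy3⟩
      simp only [R] at hy2 hy3
      exact ⟨innerCube_mono (by linarith) hy1, by linarith, by linarith⟩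
    have hhigh : μ (A z (s z) ∩ {y | K * lam < f y}) ≤ b * halfVolume n p 2 * X := by
      have := hβ R _ hRu
      rw [hRl] at this
      refine (measure_mono (inter_subset_inter_right _ fun y hy => ?_)).trans
        (this.trans (le_of_eq (by simp only [R, X]; ring)))
      refine lt_of_le_of_lt ?_ (show K * lam < f y from hy)
      calc a * (lam * halfVolume n p 2) = a * halfVolume n p 2 * lam := by ring
        _ ≤ K * lam := by gcongr
    have hlow : μ (A z (s z) ∩ {y | f y ≤ K⁻¹ * lam}) ≤ K⁻¹ * X := by
      refine (measure_inter_le_mul_volume hf (hAm _ _) _).trans (le_of_eq ?_)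
      rw [hAvol z _ hs0, mul_assoc]
    have hsum : X ≤ μ (A z (s z) ∩ B) + (K⁻¹ * X + b * halfVolume n p 2 * X) := by
      calc X ≤ μ (A z (s z)) := hlt.le
        _ ≤ μ ((A z (s z) ∩ B) ∪ ((A z (s z) ∩ {y | f y ≤ K⁻¹ * lam}) ∪
            (A z (s z) ∩ {y | K * lam < f y}))) := by
          refine measure_mono fun y hy => ?_
          by_cases h1 : f y ≤ K⁻¹ * lam
          · exact Or.inr (Or.inl ⟨hy, h1⟩)
          by_cases h2 : f y ≤ K * lam
          · exact Or.inl ⟨hy, not_le.1 h1, h2⟩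
          · exact Or.inr (Or.inr ⟨hy, not_le.1 h2⟩)
        _ ≤ _ := (measure_union_le _ _).trans (by
          gcongr; exact (measure_union_le _ _).trans (by gcongr))
    have hKb : K⁻¹ * X + b * halfVolume n p 2 * X ≠ ∞ := by
      refine ne_top_of_le_ne_top hXfin ?_
      calc K⁻¹ * X + b * halfVolume n p 2 * X = (b * halfVolume n p 2 + K⁻¹) * X := by ring
        _ ≤ 1 * X := by gcongr; exact le_self_add.trans hc
        _ = X := one_mul X
    refine (ENNReal.add_le_add_iff_right hKb).1 (le_trans ?_ hsum)
    calc c * X + (K⁻¹ * X + b * halfVolume n p 2 * X) = (b * halfVolume n p 2 + K⁻¹ + c) * X := by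
          ring
      _ ≤ 1 * X := by gcongr
      _ = X := one_mul X
  calc c * μ H ≤ c * (C * lam * volume (⋃ z ∈ J, A z (s z))) := by gcongr
    _ = C * (c * (lam * volume (⋃ z ∈ J, A z (s z)))) := by ring
    _ = C * ∑' z : J, c * (lam * volume (A z (s z))) := by
      rw [measure_biUnion hJc hJd (fun z _ => hAm _ _), ENNReal.tsum_mul_left,
        ENNReal.tsum_mul_left]
    _ ≤ C * ∑' z : J, μ (A z (s z) ∩ B) := by
      gcongr with z
      exact key z z.2
    _ = C * μ (⋃ z ∈ J, A z (s z) ∩ B) := by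
      rw [measure_biUnion hJc (hJd.mono fun z => inter_subset_left)
        (fun z _ => (hAm _ _).inter hBm)]
    _ ≤ _ := by
      gcongr
      refine iUnion₂_subset fun z hz => inter_subset_inter_left _ ?_
      obtain ⟨hs0, hsΛ, -, -⟩ := hJs z hz
      exact hAbox z (hJH hz) _ hs0 (by linarith)

end Forward

/-! ### Decay of superlevel sets and the reverse Hölder inequality -/

section Decay

variable {n : ℕ} {p : ℝ}

theorem halfVolume_eq_pow_mul (j : ℕ) {L : ℝ} (hL : 0 < L) :
    halfVolume n p L = halfVolume n p 2 ^ j * halfVolume n p ((1 / 2) ^ j * L) := by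
  induction j with
  | zero => simp
  | succ j ih =>
    rw [ih, pow_succ, mul_assoc, ← halfVolume_mul (by norm_num) (by positivity)]
    congr 2
    ring

theorem one_le_halfVolume_two (hp : 1 ≤ p) : 1 ≤ halfVolume n p 2 := by
  rw [halfVolume, ENNReal.one_le_ofReal]
  exact Real.one_le_rpow (by norm_num) (by positivity)

/-- The boxes `U j`, which shrink in time towards the lower half of `R`, absorb the boxes that leave
`U (j + 1)` at the `j`-th level, so that the stopping argument iterates to geometric decay. -/
theorem exists_geometric_decay (hp : 1 ≤ p) {f : SpaceTime n → ℝ≥0∞}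
    (hf : Measurable f) {D a b : ℝ≥0∞} (hDtop : D ≠ ∞) (hatop : a ≠ ∞)
    (hD : ∀ R : Rectangle n,
      volume.withDensity f (R.lower p) ≤ D * volume.withDensity f (R.upper p))
    (hβ : ∀ (R : Rectangle n) (t : ℝ≥0∞),
      volume.withDensity f (R.upper p) ≤ t * halfVolume n p R.L →
      volume.withDensity f (R.lower p ∩ {z | a * t < f z}) ≤ b * t * halfVolume n p R.L)
    (hb : b * halfVolume n p 2 < 1) :
    ∃ A M ρ : ℝ≥0∞, A ≠ 0 ∧ A ≠ ∞ ∧ 1 < M ∧ M ≠ ∞ ∧ ρ < 1 ∧ ∀ R : Rectangle n,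
      volume.withDensity f (R.upper p) ≠ 0 → volume.withDensity f (R.upper p) ≠ ∞ → ∀ j : ℕ,
      volume.withDensity f (R.lower p ∩
          {z | A * (volume.withDensity f (R.upper p) / halfVolume n p R.L) * M ^ j < f z})
        ≤ ρ ^ j * ((1 + D) * volume.withDensity f (R.upper p)) := by
  have hp0 : 0 < p := by linarith
  set μ := volume.withDensity f
  set θ := b * halfVolume n p 2 with hθ
  set C := (1 + D) * halfVolume n p 8 with hC
  have hCtop : C ≠ ∞ := ENNReal.mul_ne_top (by simp [hDtop]) (halfVolume_ne_top _)
  -- `c` is half of the room left by `b 2 ^ (n + p) < 1`; the summands of `K` make each of the lower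
  -- bounds required of `K` immediate
  set c := (1 - θ) / 2 with hcdef
  have hc0 : c ≠ 0 := (ENNReal.half_pos (tsub_pos_of_lt hb).ne').ne'
  have hctop : c ≠ ∞ := by
    refine ENNReal.div_ne_top (ne_top_of_le_ne_top ENNReal.one_ne_top tsub_le_self) (by norm_num)
  set K := a * halfVolume n p 2 + C + 1 + halfVolume n p 2 + c⁻¹ with hK
  have hKtop : K ≠ ∞ := by
    simp [hK, ENNReal.mul_eq_top, hatop, hCtop, hc0, halfVolume_ne_top]
  have hCK : C < K := by
    calc C < C + 1 := ENNReal.lt_add_right hCtop one_ne_zero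
      _ ≤ K := by
        rw [hK, show a * halfVolume n p 2 + C + 1 + halfVolume n p 2 + c⁻¹
          = (C + 1) + (a * halfVolume n p 2 + halfVolume n p 2 + c⁻¹) by ring]
        exact le_self_add
  have hK2 : halfVolume n p 2 ≤ K := by
    rw [hK, add_right_comm]; exact le_add_self
  have hK1 : 1 < K := by
    refine (one_le_halfVolume_two (n := n) hp).trans_lt ?_
    refine lt_of_lt_of_le (ENNReal.lt_add_right (halfVolume_ne_top 2) one_ne_zero) ?_
    rw [hK, show a * halfVolume n p 2 + C + 1 + halfVolume n p 2 + c⁻¹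
      = (halfVolume n p 2 + 1) + (a * halfVolume n p 2 + C + c⁻¹) by ring]
    exact le_self_add
  have hK0 : K ≠ 0 := (zero_lt_one.trans hK1).ne'
  have hcle : θ + K⁻¹ + c ≤ 1 := by
    have h1 : K⁻¹ ≤ c := by
      rw [ENNReal.inv_le_iff_inv_le, hK]
      exact le_add_self
    calc θ + K⁻¹ + c ≤ θ + c + c := by gcongr
      _ = θ + (1 - θ) := by rw [add_assoc, hcdef, ENNReal.add_halves]
      _ = 1 := add_tsub_cancel_of_le hb.le
  refine ⟨(1 + D) * halfVolume n p 16, K * K, C / (C + c), ?_, ?_, ?_, ?_, ?_, ?_⟩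
  · simp [(halfVolume_pos (n := n) (p := p) (show (0 : ℝ) < 16 by norm_num)).ne']
  · exact ENNReal.mul_ne_top (by simp [hDtop]) (halfVolume_ne_top _)
  · exact hK1.trans_le (le_mul_of_one_le_right' hK1.le)
  · exact ENNReal.mul_ne_top hKtop hKtop
  · exact ENNReal.div_lt_of_lt_mul (by rw [one_mul]; exact ENNReal.lt_add_right hCtop hc0)
  intro R hR0 hRtop j
  set avg := μ (R.upper p) / halfVolume n p R.L with havg
  have hVL := halfVolume_pos (n := n) (p := p) R.L_pos
  have havg0 : avg ≠ 0 := (ENNReal.div_pos hR0 (halfVolume_ne_top _)).ne'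
  have havgtop : avg ≠ ∞ := ENNReal.div_ne_top hRtop hVL.ne'
  have hup : μ (R.upper p) = avg * halfVolume n p R.L :=
    (ENNReal.div_mul_cancel hVL.ne' (halfVolume_ne_top _)).symm
  set A := (1 + D) * halfVolume n p 16 with hA
  let U : ℕ → Set (SpaceTime n) := fun j =>
    cube R.x R.L ×ˢ Ioo (R.t - R.L ^ p) (R.t + (1 / 2) ^ j * R.L ^ p)
  let h : ℕ → ℝ≥0∞ := fun j => μ (U j ∩ {z | A * avg * (K * K) ^ j < f z})
  have hLp : 0 < R.L ^ p := Real.rpow_pos_of_pos R.L_pos p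
  have hU0 : μ (U 0) ≤ (1 + D) * μ (R.upper p) := by
    calc μ (U 0) ≤ μ (R.lower p) + μ (R.upper p) := by
          simp only [U, pow_zero, one_mul]; exact measure_box_le_add f _ _ _ _ _
      _ ≤ D * μ (R.upper p) + μ (R.upper p) := by gcongr; exact hD R
      _ = _ := by ring
  have hUanti : Antitone U := by
    refine antitone_nat_of_succ_le fun j z hz => ⟨hz.1, hz.2.1, hz.2.2.trans_le ?_⟩
    have : (0 : ℝ) < (1 / 2) ^ j := by positivity
    rw [pow_succ]
    nlinarith
  -- the scale `2 ^ (-(j + 1)) L / 16` fits between `U (j + 1)` and `U j`, and at the level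
  -- `A avg K ^ (2 j + 1)` no larger box can stop
  have hstep : ∀ j, (C + c) * h (j + 1) ≤ C * h j := by
    intro j
    have hA0 : A * avg * (K * K) ^ j * K ≠ 0 := by
      simp [hA, havg0, hK0, (halfVolume_pos (n := n) (p := p) (show (0 : ℝ) < 16 by norm_num)).ne']
    have hAt : A * avg * (K * K) ^ j * K ≠ ∞ := by
      refine ENNReal.mul_ne_top (ENNReal.mul_ne_top (ENNReal.mul_ne_top ?_ havgtop) ?_) hKtop
      · exact ENNReal.mul_ne_top (by simp [hDtop]) (halfVolume_ne_top _)
      · exact ENNReal.pow_ne_top (ENNReal.mul_ne_top hKtop hKtop)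
    have hL := R.L_pos
    have hpw : (0 : ℝ) < (1 / 2) ^ (j + 1) := by positivity
    have hpw1 : ((1 : ℝ) / 2) ^ (j + 1) ≤ 1 := pow_le_one₀ (by norm_num) (by norm_num)
    have h16 : 16 * ((1 / 2) ^ (j + 1) * R.L / 16) = (1 / 2) ^ (j + 1) * R.L := by ring
    have main := measure_superlevel_le_measure_band hp hf hD hβ (K := K) (c := c)
      (lam := A * avg * (K * K) ^ j * K)
      (by rw [hK, add_assoc, add_assoc, add_assoc]; exact le_self_add) hCK hcle hA0 hAt
      (x₀ := R.x) (L₀ := R.L) (Λ := (1 / 2) ^ (j + 1) * R.L / 16) (t₁ := R.t - R.L ^ p)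
      (t₂ := R.t + (1 / 2) ^ (j + 1) * R.L ^ p) (t₃ := R.t + (1 / 2) ^ j * R.L ^ p)
      (by positivity) (by rw [h16]; nlinarith)
      (by
        rw [h16, Real.mul_rpow hpw.le hL.le]
        have : (((1 : ℝ) / 2) ^ (j + 1)) ^ p ≤ (1 / 2) ^ (j + 1) := by
          simpa using Real.rpow_le_rpow_of_exponent_ge hpw hpw1 hp
        have h2 : ((1 : ℝ) / 2) ^ j = (1 / 2) ^ (j + 1) + (1 / 2) ^ (j + 1) := by
          rw [pow_succ]; ring
        rw [h2]
        nlinarith)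
      (by
        calc μ (U j) ≤ μ (U 0) := measure_mono (hUanti (Nat.zero_le j))
          _ ≤ (1 + D) * μ (R.upper p) := hU0
          _ = (1 + D) * avg * (halfVolume n p 2 ^ (j + 1) *
              halfVolume n p ((1 / 2) ^ (j + 1) * R.L)) := by
            rw [hup, ← halfVolume_eq_pow_mul (j + 1) hL, mul_assoc]
          _ ≤ (1 + D) * avg * ((K * K) ^ j * K *
              halfVolume n p ((1 / 2) ^ (j + 1) * R.L)) := by
            gcongr
            rw [pow_succ]
            gcongr
            exact hK2.trans (le_mul_of_one_le_right' hK1.le)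
          _ = (1 + D) * avg * ((K * K) ^ j * K * (halfVolume n p 16 *
              halfVolume n p ((1 / 2) ^ (j + 1) * R.L / 16))) := by
            rw [← halfVolume_mul (by norm_num) (by positivity), h16]
          _ = _ := by rw [hA]; ring)
    have e1 : K * (A * avg * (K * K) ^ j * K) = A * avg * (K * K) ^ (j + 1) := by
      rw [pow_succ]; ring
    have e2 : K⁻¹ * (A * avg * (K * K) ^ j * K) = A * avg * (K * K) ^ j := by
      rw [mul_comm, mul_assoc, ENNReal.mul_inv_cancel hK0 hKtop, mul_one]
    rw [e1, e2] at main
    have hm : MeasurableSet (U j ∩ {z | A * avg * (K * K) ^ (j + 1) < f z}) :=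
      (measurableSet_box _ _ _ _).inter (measurableSet_lt measurable_const hf)
    have hadd : μ (U j ∩ {z | A * avg * (K * K) ^ j < f z ∧ f z ≤ A * avg * (K * K) ^ (j + 1)})
        + h (j + 1) ≤ h j := by
      calc _ ≤ μ (U j ∩ {z | A * avg * (K * K) ^ j < f z ∧ f z ≤ A * avg * (K * K) ^ (j + 1)})
            + μ (U j ∩ {z | A * avg * (K * K) ^ (j + 1) < f z}) := by
            gcongr
            exact measure_mono (inter_subset_inter_left _ (hUanti (Nat.le_succ j)))
        _ = μ (U j ∩ {z | A * avg * (K * K) ^ j < f z ∧ f z ≤ A * avg * (K * K) ^ (j + 1)} ∪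
              U j ∩ {z | A * avg * (K * K) ^ (j + 1) < f z}) := by
            refine (measure_union ?_ hm).symm
            rw [Set.disjoint_left]
            exact fun z hz hz' => absurd hz.2.2 (not_le.2 hz'.2)
        _ ≤ h j := by
            refine measure_mono (union_subset (fun z hz => ⟨hz.1, hz.2.1⟩) fun z hz => ⟨hz.1, ?_⟩)
            refine lt_of_le_of_lt ?_ (show A * avg * (K * K) ^ (j + 1) < f z from hz.2)
            rw [pow_succ]
            gcongr
            exact le_mul_of_one_le_right' (hK1.le.trans (le_mul_of_one_le_right' hK1.le))
    calc (C + c) * h (j + 1) = c * h (j + 1) + C * h (j + 1) := by ring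
      _ ≤ C * μ (U j ∩ {z | A * avg * (K * K) ^ j < f z ∧ f z ≤ A * avg * (K * K) ^ (j + 1)})
          + C * h (j + 1) := by gcongr
      _ = C * (μ (U j ∩ {z | A * avg * (K * K) ^ j < f z ∧ f z ≤ A * avg * (K * K) ^ (j + 1)})
          + h (j + 1)) := by ring
      _ ≤ C * h j := by gcongr
  have hdecay : ∀ j, h j ≤ (C / (C + c)) ^ j * ((1 + D) * μ (R.upper p)) := by
    intro j
    induction j with
    | zero =>
      rw [pow_zero, one_mul]
      exact (measure_mono inter_subset_left).trans hU0
    | succ j ih =>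
      have hCc : C + c ≠ 0 := by simp [hc0]
      have hCc' : C + c ≠ ∞ := by simp [hCtop, hctop]
      calc h (j + 1) ≤ C * h j / (C + c) := by
            rw [ENNReal.le_div_iff_mul_le (Or.inl hCc) (Or.inl hCc'), mul_comm]
            exact hstep j
        _ = C / (C + c) * h j := by rw [ENNReal.div_eq_inv_mul, ENNReal.div_eq_inv_mul]; ring
        _ ≤ C / (C + c) * ((C / (C + c)) ^ j * ((1 + D) * μ (R.upper p))) := by gcongr
        _ = _ := by rw [pow_succ]; ring
  refine (measure_mono (inter_subset_inter_left _ ?_)).trans (hdecay j)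
  intro z hz
  have : 0 < ((1 : ℝ) / 2) ^ j * R.L ^ p := by positivity
  exact ⟨hz.1, hz.2.1, hz.2.2.trans (by linarith)⟩

/-- The layers `(l M ^ j, l M ^ (j + 1)]` exhaust the values above `l`. -/
theorem exists_layer {l M x : ℝ≥0∞} (hl0 : l ≠ 0) (hltop : l ≠ ∞) (hM : 1 < M) (hx : x ≠ ∞)
    (hlx : l < x) : ∃ j : ℕ, l * M ^ j < x ∧ x ≤ l * M ^ (j + 1) := by
  have hex : ∃ m : ℕ, x ≤ l * M ^ m := by
    have h1 := ENNReal.tendsto_pow_atTop_nhds_top_iff.2 hM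
    have h2 : x / l < ∞ := ENNReal.div_lt_top hx hl0
    obtain ⟨m, hm⟩ := (h1.eventually (lt_mem_nhds h2)).exists
    refine ⟨m, ?_⟩
    rw [mul_comm]
    exact (ENNReal.div_le_iff hl0 hltop).1 hm.le
  classical
  obtain ⟨m, hm⟩ : ∃ m, Nat.find hex = m + 1 := by
    refine Nat.exists_eq_succ_of_ne_zero fun h0 => hlx.not_ge ?_
    have := Nat.find_spec hex
    rwa [h0, pow_zero, mul_one] at this
  refine ⟨m, not_le.1 (Nat.find_min hex (by omega)), ?_⟩
  have := Nat.find_spec hex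
  rwa [hm] at this

/-- Geometric decay of the mass of the superlevel sets sums to a reverse Hölder inequality. -/
theorem exists_reverseHolder_of_decay {f : SpaceTime n → ℝ≥0∞}
    (hf : Measurable f) (hftop : ∀ z, f z ≠ ∞) {D A M ρ : ℝ≥0∞} (hDtop : D ≠ ∞)
    (hD : ∀ R : Rectangle n,
      volume.withDensity f (R.lower p) ≤ D * volume.withDensity f (R.upper p))
    (hA0 : A ≠ 0) (hAtop : A ≠ ∞) (hM : 1 < M) (hMtop : M ≠ ∞) (hρ : ρ < 1)
    (hdecay : ∀ R : Rectangle n,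
      volume.withDensity f (R.upper p) ≠ 0 → volume.withDensity f (R.upper p) ≠ ∞ → ∀ j : ℕ,
      volume.withDensity f (R.lower p ∩
          {z | A * (volume.withDensity f (R.upper p) / halfVolume n p R.L) * M ^ j < f z})
        ≤ ρ ^ j * ((1 + D) * volume.withDensity f (R.upper p))) :
    ∃ (δ : ℝ) (C : ℝ≥0∞), 0 < δ ∧ C ≠ ∞ ∧ ∀ R : Rectangle n,
      volume.withDensity f (R.upper p) ≠ 0 → volume.withDensity f (R.upper p) ≠ ∞ →
      ∫⁻ z in R.lower p, f z ^ (1 + δ) ≤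
        C * (volume.withDensity f (R.upper p) / halfVolume n p R.L) ^ (1 + δ)
          * halfVolume n p R.L := by
  set μ := volume.withDensity f
  obtain ⟨δ, hδ, hMδ⟩ : ∃ δ : ℝ, 0 < δ ∧ M ^ δ * ρ < 1 := by
    obtain ⟨y, hy1, hy2⟩ := ENNReal.lt_iff_exists_nnreal_btwn.1 (ENNReal.one_lt_inv.2 hρ)
    lift M to ℝ≥0 using hMtop
    have hM' : (1 : ℝ) < M := by exact_mod_cast hM
    have hy' : (1 : ℝ) < y := by exact_mod_cast hy1
    refine ⟨Real.logb M y, Real.logb_pos hM' hy', ?_⟩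
    have : ((M : ℝ≥0∞)) ^ Real.logb M y = y := by
      rw [← ENNReal.coe_rpow_of_nonneg _ (Real.logb_pos hM' hy').le]
      norm_cast
      rw [← NNReal.coe_inj, NNReal.coe_rpow, Real.rpow_logb (by linarith) hM'.ne' (by linarith)]
    rw [this]
    exact ENNReal.mul_lt_of_lt_div (by rwa [one_div])
  have hMδtop : M ^ δ ≠ ∞ := ENNReal.rpow_ne_top_of_nonneg hδ.le hMtop
  refine ⟨δ, A ^ δ * (D + M ^ δ * (1 + D) * (1 - M ^ δ * ρ)⁻¹), hδ, ?_, ?_⟩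
  · refine ENNReal.mul_ne_top (ENNReal.rpow_ne_top_of_nonneg hδ.le hAtop) ?_
    have : (1 - M ^ δ * ρ)⁻¹ ≠ ∞ :=
      ENNReal.inv_ne_top.2 (tsub_pos_of_lt hMδ).ne'
    simp only [ne_eq, ENNReal.add_eq_top, hDtop, false_or]
    exact ENNReal.mul_ne_top (ENNReal.mul_ne_top hMδtop (by simp [hDtop])) this
  intro R hR0 hRtop
  have hVL := halfVolume_pos (n := n) (p := p) R.L_pos
  set avg := μ (R.upper p) / halfVolume n p R.L with havg
  have havg0 : avg ≠ 0 := (ENNReal.div_pos hR0 (halfVolume_ne_top _)).ne'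
  have havgtop : avg ≠ ∞ := ENNReal.div_ne_top hRtop hVL.ne'
  have hup : μ (R.upper p) = avg * halfVolume n p R.L :=
    (ENNReal.div_mul_cancel hVL.ne' (halfVolume_ne_top _)).symm
  set l := A * avg with hl
  have hl0 : l ≠ 0 := mul_ne_zero hA0 havg0
  have hltop : l ≠ ∞ := ENNReal.mul_ne_top hAtop havgtop
  let S : ℕ → Set (SpaceTime n) := fun j => {z | l * M ^ j < f z}
  have hS : ∀ j, MeasurableSet (S j) := fun j => measurableSet_lt measurable_const hf
  have hRm := measurableSet_lower (p := p) R
  -- each value of `f` above `l` lies in one layer `(l M ^ j, l M ^ (j + 1)]`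
  have hpt : ∀ z, f z ^ δ ≤
      l ^ δ + ∑' j : ℕ, (S j).indicator (fun _ => (l * M ^ (j + 1)) ^ δ) z := by
    intro z
    by_cases hz : f z ≤ l
    · exact (ENNReal.rpow_le_rpow hz hδ.le).trans le_self_add
    obtain ⟨m, h2, h1⟩ := exists_layer hl0 hltop hM (hftop z) (not_le.1 hz)
    have h2 : z ∈ S m := h2
    calc f z ^ δ ≤ (l * M ^ (m + 1)) ^ δ := ENNReal.rpow_le_rpow h1 hδ.le
      _ = (S m).indicator (fun _ => (l * M ^ (m + 1)) ^ δ) z := by rw [indicator_of_mem h2]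
      _ ≤ ∑' j : ℕ, (S j).indicator (fun _ => (l * M ^ (j + 1)) ^ δ) z :=
          ENNReal.le_tsum (f := fun j => (S j).indicator (fun _ => (l * M ^ (j + 1)) ^ δ) z) m
      _ ≤ _ := le_add_self
  calc ∫⁻ z in R.lower p, f z ^ (1 + δ) = ∫⁻ z in R.lower p, f z ^ δ ∂μ := by
        rw [setLIntegral_withDensity_eq_setLIntegral_mul volume hf (hf.pow_const δ) hRm]
        refine lintegral_congr fun z => ?_
        rw [ENNReal.rpow_add_of_nonneg _ _ zero_le_one hδ.le, ENNReal.rpow_one]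
        rfl
    _ ≤ ∫⁻ z in R.lower p, (l ^ δ +
          ∑' j : ℕ, (S j).indicator (fun _ => (l * M ^ (j + 1)) ^ δ) z) ∂μ :=
        lintegral_mono fun z => hpt z
    _ = l ^ δ * μ (R.lower p) + ∑' j : ℕ, (l * M ^ (j + 1)) ^ δ * μ (R.lower p ∩ S j) := by
        rw [lintegral_add_left measurable_const, setLIntegral_const, lintegral_tsum
          (fun j => (measurable_const.indicator (hS j)).aemeasurable)]
        congr 2
        ext j
        rw [lintegral_indicator_const (hS j), Measure.restrict_apply (hS j), inter_comm]
    _ ≤ l ^ δ * (D * μ (R.upper p)) +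
          ∑' j : ℕ, (l * M ^ (j + 1)) ^ δ * (ρ ^ j * ((1 + D) * μ (R.upper p))) := by
        gcongr with j
        · exact hD R
        · exact hdecay R hR0 hRtop j
    _ = l ^ δ * (D * μ (R.upper p)) +
          ∑' j : ℕ, (l ^ δ * M ^ δ * ((1 + D) * μ (R.upper p))) * (M ^ δ * ρ) ^ j := by
        congr 2
        ext j
        rw [ENNReal.mul_rpow_of_nonneg _ _ hδ.le, ← ENNReal.rpow_natCast, ← ENNReal.rpow_mul,
          mul_comm ((j + 1 : ℕ) : ℝ) δ, ENNReal.rpow_mul, ENNReal.rpow_natCast, pow_succ, mul_pow]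
        ring
    _ = l ^ δ * (D + M ^ δ * (1 + D) * (1 - M ^ δ * ρ)⁻¹) * μ (R.upper p) := by
        rw [ENNReal.tsum_mul_left, ENNReal.tsum_geometric]
        ring
    _ = _ := by
        rw [hl, ENNReal.mul_rpow_of_nonneg _ _ hδ.le, hup,
          ENNReal.rpow_add_of_nonneg _ _ zero_le_one hδ.le, ENNReal.rpow_one]
        ring

end Decay

/-! ### Upper bounds for the forward maximal function -/

section Maximal

variable {n : ℕ} {p : ℝ}

/-- The uncentred forward in time maximal function of a measure. -/
noncomputable def forwardMaximal (p : ℝ) (ν : Measure (SpaceTime n)) (z : SpaceTime n) : ℝ≥0∞ :=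
  ⨆ (R : Rectangle n) (_ : z ∈ R.lower p), ν (R.upper p) / halfVolume n p R.L

theorem le_forwardMaximal (ν : Measure (SpaceTime n)) {z : SpaceTime n} {R : Rectangle n}
    (hz : z ∈ R.lower p) : ν (R.upper p) / halfVolume n p R.L ≤ forwardMaximal p ν z :=
  le_iSup₂ (f := fun (R : Rectangle n) (_ : z ∈ R.lower p) =>
    ν (R.upper p) / halfVolume n p R.L) R hz

/-- The weak type `(1, 1)` estimate for the forward maximal function, with the mass on the right
restricted to a superlevel set. -/
theorem mul_volume_forwardMaximal_le (hp : 1 ≤ p) {g : SpaceTime n → ℝ≥0∞} (hg : Measurable g)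
    (hfin : volume.withDensity g univ ≠ ∞) {t : ℝ≥0∞} (ht0 : t ≠ 0) (ht : t ≠ ∞) :
    t * volume {z | 2 * t < forwardMaximal p (volume.withDensity g) z}
      ≤ 2 * halfVolume n p 8 * volume.withDensity g {z | t < g z} := by
  have hp0 : 0 < p := by linarith
  set ν := volume.withDensity g
  set E := {z | 2 * t < forwardMaximal p ν z}
  have hex : ∀ z : SpaceTime n, z ∈ E → ∃ R : Rectangle n, z ∈ R.lower p ∧
      2 * t * halfVolume n p R.L < ν (R.upper p) := by
    intro z hz
    have hz' : 2 * t < forwardMaximal p ν z := hz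
    simp only [forwardMaximal, lt_iSup_iff] at hz'
    obtain ⟨R, hR, h⟩ := hz'
    exact ⟨R, hR, ENNReal.mul_lt_of_lt_div h⟩
  have : Nonempty (Rectangle n) := ⟨⟨0, 0, 1, one_pos⟩⟩
  choose! R hRz hR using hex
  have hbig : ∀ z ∈ E, t * halfVolume n p (R z).L < ν ((R z).upper p ∩ {y | t < g y}) := by
    intro z hz
    have h1 := measure_inter_le_mul_volume hg (measurableSet_upper (p := p) (R z)) t
    rw [volume_upper] at h1
    by_contra hcon
    refine (hR z hz).not_ge ?_
    calc ν ((R z).upper p)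
        ≤ ν (((R z).upper p ∩ {y | g y ≤ t}) ∪ ((R z).upper p ∩ {y | t < g y})) := by
          refine measure_mono fun y hy => ?_
          rcases le_or_gt (g y) t with h | h
          · exact Or.inl ⟨hy, h⟩
          · exact Or.inr ⟨hy, h⟩
      _ ≤ t * halfVolume n p (R z).L + t * halfVolume n p (R z).L :=
          (measure_union_le _ _).trans (add_le_add h1 (not_lt.1 hcon))
      _ = 2 * t * halfVolume n p (R z).L := by ring
  -- the side lengths are bounded because the total mass is finite
  obtain ⟨Λ, hΛ⟩ : ∃ Λ : ℝ, ∀ z ∈ E, (R z).L ≤ Λ := by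
    refine ⟨max 1 (ν univ / t).toReal, fun z hz => ?_⟩
    by_cases h1 : (R z).L ≤ 1
    · exact h1.trans (le_max_left _ _)
    refine le_trans ?_ (le_max_right _ _)
    have h2 : t * halfVolume n p (R z).L ≤ ν univ :=
      (hbig z hz).le.trans (measure_mono (subset_univ _))
    have h3 : halfVolume n p (R z).L ≤ ν univ / t :=
      (ENNReal.le_div_iff_mul_le (Or.inl ht0) (Or.inl ht)).2 (by rwa [mul_comm])
    have h4 : ENNReal.ofReal (R z).L ≤ halfVolume n p (R z).L := by
      refine ENNReal.ofReal_le_ofReal ?_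
      conv_lhs => rw [← Real.rpow_one (R z).L]
      exact Real.rpow_le_rpow_of_exponent_le (not_le.1 h1).le
        (by linarith [(Nat.cast_nonneg n : (0 : ℝ) ≤ n)])
    exact (ENNReal.ofReal_le_iff_le_toReal (ENNReal.div_ne_top hfin ht0)).1 (h4.trans h3)
  obtain ⟨J, hJE, hJc, hJd, hJ⟩ := exists_disjoint_subfamily_measure_le volume (E := E)
    (V := fun z => (R z).upper p) (V' := fun z => cube (R z).x (8 * (R z).L) ×ˢ
      Ioo ((R z).t - (8 * (R z).L) ^ p) ((R z).t + (8 * (R z).L) ^ p)) (s := fun z => (R z).L)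
    (Λ := Λ) (c := 2 * halfVolume n p 8) (fun z hz => ⟨(R z).L_pos, hΛ z hz⟩)
    (fun z _ => measurableSet_upper _)
    (fun z _ => by rw [volume_upper]; exact halfVolume_pos (R z).L_pos)
    (by
      rintro z hz z' hz' hss ⟨y, hy, hy'⟩
      have hz1 := hRz z hz
      have hs := (R z).L_pos
      have hs' := (R z').L_pos
      have h1 : (R z).L ^ p ≤ (2 * (R z').L) ^ p := Real.rpow_le_rpow hs.le hss hp0.le
      have h2 := rpow_add_rpow_le_rpow_add hp (a := 2 * (R z').L) (b := 2 * (R z').L)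
        (by positivity) (by positivity)
      have h3 : (2 * (R z').L + 2 * (R z').L) ^ p ≤ (8 * (R z').L) ^ p :=
        Real.rpow_le_rpow (by positivity) (by linarith) hp0.le
      have h4 : (R z').L ^ p ≤ (8 * (R z').L) ^ p :=
        Real.rpow_le_rpow (by positivity) (by linarith) hp0.le
      refine ⟨fun i => ?_, ?_, ?_⟩
      · have a1 := abs_le.1 (hz1.1 i)
        have a2 := abs_le.1 (hy.1 i)
        have a3 := abs_le.1 (hy'.1 i)
        rw [abs_le]
        constructor <;> linarith
      · linarith [hz1.2.1, hy.2.2, hy'.2.1]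
      · linarith [hz1.2.2, hy.2.1, hy'.2.2])
    (by
      intro z hz
      have hs := (R z).L_pos
      rw [volume_upper, volume_box _ (by positivity), mul_assoc,
        ← halfVolume_mul (by norm_num) hs.le, halfVolume_eq (by positivity),
        show (R z).t + (8 * (R z).L) ^ p - ((R z).t - (8 * (R z).L) ^ p)
          = 2 * (8 * (R z).L) ^ p by ring, ENNReal.ofReal_mul zero_le_two, ENNReal.ofReal_ofNat]
      exact le_of_eq (by ring))
  have hBm : MeasurableSet {y | t < g y} := measurableSet_lt measurable_const hg
  calc t * volume E ≤ t * (2 * halfVolume n p 8 * volume (⋃ z ∈ J, (R z).upper p)) := by gcongr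
    _ = 2 * halfVolume n p 8 * ∑' z : J, t * halfVolume n p (R z).L := by
        rw [measure_biUnion hJc hJd (fun z _ => measurableSet_upper _), ENNReal.tsum_mul_left]
        simp_rw [volume_upper]
        ring
    _ ≤ 2 * halfVolume n p 8 * ∑' z : J, ν ((R z).upper p ∩ {y | t < g y}) := by
        gcongr with z
        exact (hbig z (hJE z.2)).le
    _ = 2 * halfVolume n p 8 * ν (⋃ z ∈ J, (R z).upper p ∩ {y | t < g y}) := by
        rw [measure_biUnion hJc (hJd.mono fun z => inter_subset_left)
          (fun z _ => (measurableSet_upper _).inter hBm)]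
    _ ≤ _ := by
        gcongr
        exact iUnion₂_subset fun z hz => inter_subset_right

theorem withDensity_indicator_apply {f : SpaceTime n → ℝ≥0∞} {U S : Set (SpaceTime n)}
    (hU : MeasurableSet U) (hS : MeasurableSet S) :
    volume.withDensity (U.indicator f) S = volume.withDensity f (S ∩ U) := by
  rw [withDensity_indicator hU, withDensity_apply _ hS, withDensity_apply _ (hS.inter hU),
    Measure.restrict_restrict hS]

theorem withDensity_indicator_eq_restrict {f : SpaceTime n → ℝ≥0∞} {U : Set (SpaceTime n)}
    (hU : MeasurableSet U) :
    volume.withDensity (U.indicator f) = (volume.withDensity f).restrict U := by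
  ext S hS
  rw [withDensity_indicator_apply hU hS, Measure.restrict_apply hS]

/-- A reverse Hölder inequality on `R` bounds the integral of the forward maximal function of the
lower half, by the weak type estimate and Chebyshev's inequality. -/
theorem exists_lintegral_forwardMaximal_le (hp : 1 ≤ p) {f : SpaceTime n → ℝ≥0∞}
    (hf : Measurable f) {δ : ℝ} (hδ : 0 < δ) {C : ℝ≥0∞} (hC : C ≠ ∞) :
    ∃ C' : ℝ≥0∞, C' ≠ ∞ ∧ ∀ R : Rectangle n, volume.withDensity f (R.lower p) ≠ ∞ →
      volume.withDensity f (R.upper p) ≠ 0 → volume.withDensity f (R.upper p) ≠ ∞ →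
      ∫⁻ z in R.lower p, f z ^ (1 + δ) ≤
        C * (volume.withDensity f (R.upper p) / halfVolume n p R.L) ^ (1 + δ)
          * halfVolume n p R.L →
      ∫⁻ z in R.lower p, forwardMaximal p ((volume.withDensity f).restrict (R.lower p)) z
        ≤ C' * volume.withDensity f (R.upper p) := by
  set μ := volume.withDensity f
  have h2δ : (2 : ℝ≥0∞) ^ (-δ) < 1 :=
    ENNReal.rpow_lt_one_of_one_lt_of_neg (by norm_num) (by linarith)
  refine ⟨2 + 4 * (2 * halfVolume n p 8) * C * (1 - 2 ^ (-δ))⁻¹, ?_, ?_⟩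
  · have h1 : (1 - (2 : ℝ≥0∞) ^ (-δ))⁻¹ ≠ ∞ := ENNReal.inv_ne_top.2 (tsub_pos_of_lt h2δ).ne'
    refine ENNReal.add_ne_top.2 ⟨by norm_num, ENNReal.mul_ne_top (ENNReal.mul_ne_top ?_ hC) h1⟩
    exact ENNReal.mul_ne_top (by norm_num) (ENNReal.mul_ne_top (by norm_num) (halfVolume_ne_top _))
  intro R hRl hR0 hRtop hRH
  have hRm := measurableSet_lower (p := p) R
  have hVL := halfVolume_pos (n := n) (p := p) R.L_pos
  set avg := μ (R.upper p) / halfVolume n p R.L with havg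
  have havg0 : avg ≠ 0 := (ENNReal.div_pos hR0 (halfVolume_ne_top _)).ne'
  have havgtop : avg ≠ ∞ := ENNReal.div_ne_top hRtop hVL.ne'
  have hup : μ (R.upper p) = avg * halfVolume n p R.L :=
    (ENNReal.div_mul_cancel hVL.ne' (halfVolume_ne_top _)).symm
  set g := (R.lower p).indicator f
  have hg : Measurable g := hf.indicator hRm
  have hν : μ.restrict (R.lower p) = volume.withDensity g :=
    (withDensity_indicator_eq_restrict hRm).symm
  rw [hν]
  set m := forwardMaximal p (volume.withDensity g)
  let t : ℕ → ℝ≥0∞ := fun j => 2 ^ j * avg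
  have ht0 : ∀ j, t j ≠ 0 := fun j => mul_ne_zero (by simp) havg0
  have httop : ∀ j, t j ≠ ∞ := fun j => ENNReal.mul_ne_top (by simp) havgtop
  -- measurable hulls avoid the measurability of the maximal function
  let S : ℕ → Set (SpaceTime n) := fun j => toMeasurable volume {z | 2 * t j < m z}
  have hS : ∀ j, MeasurableSet (S j) := fun j => measurableSet_toMeasurable _ _
  have hpt : ∀ z, m z ≤ 2 * avg + ∑' j : ℕ, (S j).indicator (fun _ => 4 * t j) z := by
    intro z
    by_cases hz : m z ≤ 2 * avg
    · exact hz.trans le_self_add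
    have hl0 : 2 * avg ≠ 0 := mul_ne_zero two_ne_zero havg0
    have hlt : 2 * avg ≠ ∞ := ENNReal.mul_ne_top (by norm_num) havgtop
    -- the maximal function may be infinite, in which case `z` lies in every `S j`
    by_cases hztop : m z = ∞
    · have hall : ∀ j, z ∈ S j := fun j => subset_toMeasurable _ _ (by
        simp only [mem_ofPred_eq, hztop]
        exact ENNReal.mul_lt_top (by norm_num) (httop j).lt_top)
      have : ∑' j : ℕ, (S j).indicator (fun _ => 4 * t j) z = ∞ := by
        refine top_unique ?_
        rw [← ENNReal.tsum_const_eq_top_of_ne_zero (α := ℕ) havg0]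
        refine ENNReal.tsum_le_tsum fun j => ?_
        rw [indicator_of_mem (hall j)]
        simp only [t]
        rw [← mul_assoc]
        exact le_mul_of_one_le_left' (one_le_mul (by norm_num) (one_le_pow₀ (by norm_num)))
      rw [this, add_top]
      exact le_top
    · obtain ⟨j, h1, h2⟩ := exists_layer hl0 hlt (M := 2) (by norm_num) hztop (not_le.1 hz)
      have hj : z ∈ S j := subset_toMeasurable _ _ (by
        simp only [mem_ofPred_eq, t]
        refine lt_of_eq_of_lt ?_ h1
        ring)
      calc m z ≤ 2 * avg * 2 ^ (j + 1) := h2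
        _ = (S j).indicator (fun _ => 4 * t j) z := by
          rw [indicator_of_mem hj]
          simp only [t]
          ring
        _ ≤ _ := ENNReal.le_tsum (f := fun j => (S j).indicator (fun _ => 4 * t j) z) j
        _ ≤ _ := le_add_self
  have hcheb : ∀ j, volume.withDensity g {z | t j < g z}
      ≤ C * avg * halfVolume n p R.L * (2 ^ (-δ)) ^ j := by
    intro j
    have hm : MeasurableSet {z | t j < f z} := measurableSet_lt measurable_const hf
    have htδ0 : t j ^ δ ≠ 0 := by simp [ENNReal.rpow_eq_zero_iff, ht0 j, httop j]
    have htδt : t j ^ δ ≠ ∞ := ENNReal.rpow_ne_top_of_nonneg hδ.le (httop j)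
    have h1 : t j ^ δ * volume.withDensity g {z | t j < g z}
        ≤ C * avg ^ (1 + δ) * halfVolume n p R.L := by
      refine le_trans ?_ hRH
      have hsub : {z | t j < g z} ⊆ R.lower p ∩ {z | t j < f z} := by
        intro z hz
        have hz : t j < g z := hz
        have hzR : z ∈ R.lower p := by
          by_contra h
          simp [g, indicator_of_notMem h] at hz
        refine ⟨hzR, ?_⟩
        change t j < f z
        simpa only [g, indicator_of_mem hzR] using hz
      rw [← hν]
      calc t j ^ δ * μ.restrict (R.lower p) {z | t j < g z}
          ≤ t j ^ δ * μ (R.lower p ∩ {z | t j < f z}) := by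
            refine mul_le_mul' le_rfl ?_
            exact (Measure.restrict_le_self _).trans (measure_mono hsub)
        _ = ∫⁻ z in R.lower p ∩ {z | t j < f z}, t j ^ δ * f z := by
            rw [lintegral_const_mul _ hf, withDensity_apply _ (hRm.inter hm)]
        _ ≤ ∫⁻ z in R.lower p ∩ {z | t j < f z}, f z ^ (1 + δ) := by
            refine setLIntegral_mono' (hRm.inter hm) fun z hz => ?_
            rw [ENNReal.rpow_add_of_nonneg _ _ zero_le_one hδ.le, ENNReal.rpow_one, mul_comm]
            gcongr
            exact le_of_lt hz.2
        _ ≤ _ := lintegral_mono_set inter_subset_left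
    refine (ENNReal.mul_le_mul_iff_right htδ0 htδt).1 (h1.trans (le_of_eq ?_))
    have h2 : (2 ^ j : ℝ≥0∞) ^ δ * (2 ^ (-δ)) ^ j = 1 := by
      rw [← ENNReal.rpow_natCast, ← ENNReal.rpow_natCast, ← ENNReal.rpow_mul, ← ENNReal.rpow_mul,
        ← ENNReal.rpow_add _ _ two_ne_zero (by norm_num)]
      simp [mul_comm]
    calc C * avg ^ (1 + δ) * halfVolume n p R.L
        = C * avg ^ (1 + δ) * halfVolume n p R.L * ((2 ^ j : ℝ≥0∞) ^ δ * (2 ^ (-δ)) ^ j) := by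
          rw [h2, mul_one]
      _ = _ := by
          simp only [t]
          rw [ENNReal.mul_rpow_of_nonneg _ _ hδ.le,
            ENNReal.rpow_add_of_nonneg _ _ zero_le_one hδ.le, ENNReal.rpow_one]
          ring
  have hgfin : volume.withDensity g univ ≠ ∞ := by
    rw [← hν, Measure.restrict_apply_univ]
    exact hRl
  calc ∫⁻ z in R.lower p, m z
      ≤ ∫⁻ z in R.lower p, (2 * avg + ∑' j : ℕ, (S j).indicator (fun _ => 4 * t j) z) :=
        lintegral_mono fun z => hpt z
    _ = 2 * avg * halfVolume n p R.L + ∑' j : ℕ, 4 * t j * volume (S j ∩ R.lower p) := by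
        rw [lintegral_add_left measurable_const, setLIntegral_const, volume_lower, lintegral_tsum
          (fun j => (measurable_const.indicator (hS j)).aemeasurable)]
        congr 2
        ext j
        rw [lintegral_indicator_const (hS j), Measure.restrict_apply (hS j)]
    _ ≤ 2 * avg * halfVolume n p R.L + ∑' j : ℕ, 4 * (2 * halfVolume n p 8) * C * avg *
          halfVolume n p R.L * (2 ^ (-δ)) ^ j := by
        refine add_le_add le_rfl (ENNReal.tsum_le_tsum fun j => ?_)
        calc 4 * t j * volume (S j ∩ R.lower p) ≤ 4 * (t j * volume {z | 2 * t j < m z}) := by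
              rw [mul_assoc, ← measure_toMeasurable {z | 2 * t j < m z}]
              gcongr
              exact inter_subset_left
          _ ≤ 4 * (2 * halfVolume n p 8 * (C * avg * halfVolume n p R.L * (2 ^ (-δ)) ^ j)) := by
              refine mul_le_mul' le_rfl ?_
              exact (mul_volume_forwardMaximal_le hp hg hgfin (ht0 j) (httop j)).trans
                (mul_le_mul' le_rfl (hcheb j))
          _ = _ := by ring
    _ = _ := by
        rw [ENNReal.tsum_mul_left, ENNReal.tsum_geometric, hup]
        ring

end Maximal

/-! ### Lower bounds for the forward maximal function -/

section MaximalLower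

variable {n : ℕ} {p : ℝ}

/-- The maximal function condition moves the mass of the second half of `R⁻` into `R⁺`: on the
first half of `R⁻` the maximal function is at least the mass of the second half over `|R⁺|`. -/
theorem measure_secondHalf_le {f : SpaceTime n → ℝ≥0∞} {C : ℝ≥0∞}
    (hM : ∀ R : Rectangle n,
      ∫⁻ z in R.lower p, forwardMaximal p ((volume.withDensity f).restrict (R.lower p)) z
        ≤ C * volume.withDensity f (R.upper p)) (R : Rectangle n) :
    volume.withDensity f (cube R.x R.L ×ˢ Ioo (R.t - R.L ^ p / 2) R.t)
      ≤ 2 * C * volume.withDensity f (R.upper p) := by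
  set μ := volume.withDensity f
  have hL := R.L_pos
  have hLp : 0 < R.L ^ p := Real.rpow_pos_of_pos hL p
  have hVL := halfVolume_pos (n := n) (p := p) hL
  set W : Set (SpaceTime n) := cube R.x R.L ×ˢ Ioo (R.t - R.L ^ p / 2) R.t
  let F : Set (SpaceTime n) := cube R.x R.L ×ˢ Ioo (R.t - R.L ^ p) (R.t - R.L ^ p / 2)
  have hF : volume F = halfVolume n p R.L / 2 := by
    simp only [F]
    rw [volume_box _ hL.le, halfVolume_eq hL,
      show R.t - R.L ^ p / 2 - (R.t - R.L ^ p) = R.L ^ p / 2 by ring,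
      ENNReal.ofReal_div_of_pos two_pos, ENNReal.ofReal_ofNat, mul_div_assoc]
  have hFR : F ⊆ R.lower p := fun z hz => ⟨hz.1, hz.2.1, by linarith [hz.2.2]⟩
  let P : Rectangle n := ⟨R.x, R.t - R.L ^ p / 2, R.L, hL⟩
  have hlow : ∀ z ∈ F, μ W / halfVolume n p R.L
      ≤ forwardMaximal p (μ.restrict (R.lower p)) z := by
    intro z hz
    have hzP : z ∈ P.lower p := ⟨hz.1, by simp only [P]; linarith [hz.2.1], hz.2.2⟩
    refine le_trans ?_ (le_forwardMaximal _ hzP)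
    refine ENNReal.div_le_div_right ?_ _
    rw [Measure.restrict_apply (measurableSet_upper P)]
    refine measure_mono fun y hy => ⟨⟨hy.1, hy.2.1, ?_⟩, hy.1, ?_, hy.2.2⟩
    · simp only [P]; linarith [hy.2.2]
    · linarith [hy.2.1]
  have h1 : μ W / halfVolume n p R.L * (halfVolume n p R.L / 2) ≤ C * μ (R.upper p) := by
    calc μ W / halfVolume n p R.L * (halfVolume n p R.L / 2)
        = ∫⁻ _ in F, μ W / halfVolume n p R.L := by rw [setLIntegral_const, hF]
      _ ≤ ∫⁻ z in F, forwardMaximal p (μ.restrict (R.lower p)) z :=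
          setLIntegral_mono' (measurableSet_box _ _ _ _) hlow
      _ ≤ ∫⁻ z in R.lower p, forwardMaximal p (μ.restrict (R.lower p)) z :=
          lintegral_mono_set hFR
      _ ≤ _ := hM R
  calc μ W = 2 * (μ W / halfVolume n p R.L * (halfVolume n p R.L / 2)) := by
        rw [← mul_div_assoc, ENNReal.div_mul_cancel hVL.ne' (halfVolume_ne_top _),
          ENNReal.mul_div_cancel two_ne_zero (by norm_num)]
    _ ≤ 2 * (C * μ (R.upper p)) := by gcongr
    _ = _ := by ring

/-- The rectangle `R` moved back in time by half the length of `R⁻`. -/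
noncomputable def shiftDown (p : ℝ) (R : Rectangle n) : Rectangle n :=
  ⟨R.x, R.t - R.L ^ p / 2, R.L, R.L_pos⟩

theorem measure_upper_shiftDown_le {f : SpaceTime n → ℝ≥0∞} {C : ℝ≥0∞}
    (hM : ∀ R : Rectangle n,
      ∫⁻ z in R.lower p, forwardMaximal p ((volume.withDensity f).restrict (R.lower p)) z
        ≤ C * volume.withDensity f (R.upper p)) (R : Rectangle n) :
    volume.withDensity f ((shiftDown p R).upper p)
      ≤ (2 * C + 1) * volume.withDensity f (R.upper p) := by
  have hLp : 0 < R.L ^ p := Real.rpow_pos_of_pos R.L_pos p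
  calc volume.withDensity f ((shiftDown p R).upper p)
      ≤ volume.withDensity f (cube R.x R.L ×ˢ Ioo (R.t - R.L ^ p / 2) R.t)
        + volume.withDensity f (cube R.x R.L ×ˢ Ioo R.t (R.t - R.L ^ p / 2 + R.L ^ p)) :=
        measure_box_le_add f _ _ _ _ _
    _ ≤ 2 * C * volume.withDensity f (R.upper p) + volume.withDensity f (R.upper p) := by
        refine add_le_add (measure_secondHalf_le hM R) (measure_mono fun z hz => ?_)
        exact ⟨hz.1, hz.2.1, by linarith [hz.2.2]⟩
    _ = _ := by ring

theorem exists_doubling_of_forwardMaximal {f : SpaceTime n → ℝ≥0∞} {C : ℝ≥0∞} (hC : C ≠ ∞)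
    (hM : ∀ R : Rectangle n,
      ∫⁻ z in R.lower p, forwardMaximal p ((volume.withDensity f).restrict (R.lower p)) z
        ≤ C * volume.withDensity f (R.upper p)) :
    ∃ D : ℝ≥0∞, D ≠ ∞ ∧ ∀ R : Rectangle n,
      volume.withDensity f (R.lower p) ≤ D * volume.withDensity f (R.upper p) := by
  refine ⟨2 * C * (2 * C + 1) + 2 * C, by simp [ENNReal.mul_eq_top, hC], fun R => ?_⟩
  have h1 := measure_secondHalf_le hM (shiftDown p R)
  have e : (shiftDown p R).t - (shiftDown p R).L ^ p / 2 = R.t - R.L ^ p := by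
    simp only [shiftDown]; ring
  rw [e] at h1
  calc volume.withDensity f (R.lower p)
      ≤ volume.withDensity f (cube R.x R.L ×ˢ Ioo (R.t - R.L ^ p) (R.t - R.L ^ p / 2))
        + volume.withDensity f (cube R.x R.L ×ˢ Ioo (R.t - R.L ^ p / 2) R.t) :=
        measure_box_le_add f _ _ _ _ _
    _ ≤ 2 * C * ((2 * C + 1) * volume.withDensity f (R.upper p))
        + 2 * C * volume.withDensity f (R.upper p) :=
        add_le_add (h1.trans (mul_le_mul' le_rfl (measure_upper_shiftDown_le hM R)))
          (measure_secondHalf_le hM R)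
    _ = _ := by ring

/-- The last five eighths of `R⁻` in time. A box of small scale around one of its points has its
past neighbour inside `R⁻`, though the box itself may cross the top of `R⁻`. -/
def latePart (p : ℝ) (R : Rectangle n) : Set (SpaceTime n) :=
  cube R.x R.L ×ˢ Ioo (R.t - 5 / 8 * R.L ^ p) R.t

/-- A reverse weak type estimate. The superlevel set of the density at height `K lam` is covered by
boxes at stopping scales, and in the past of every such box the forward maximal function
is at least a multiple of `lam`. -/
theorem exists_forwardMaximal_ge (hp : 1 ≤ p) {f : SpaceTime n → ℝ≥0∞} (hf : Measurable f)
    (R : Rectangle n) {lam : ℝ≥0∞} (hlam0 : lam ≠ 0) (hlam : lam ≠ ∞)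
    (htot : volume.withDensity f (R.lower p) ≤ lam * halfVolume n p (R.L / 8)) :
    ∃ F ⊆ R.lower p, MeasurableSet F ∧
      (∀ z ∈ F, lam / halfVolume n p 2
        ≤ forwardMaximal p ((volume.withDensity f).restrict (R.lower p)) z) ∧
      volume.withDensity f (latePart p R ∩ {z | (halfVolume n p 8 + 1) * lam < f z})
        ≤ 2 * halfVolume n p 8 * (lam * volume F) := by
  have hp0 : 0 < p := by linarith
  set μ := volume.withDensity f
  have hL := R.L_pos
  have hLp : 0 < R.L ^ p := Real.rpow_pos_of_pos hL p
  set U := latePart p R with hUdef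
  have hUm : MeasurableSet U := measurableSet_box _ _ _ _
  have hUR : U ⊆ R.lower p := fun z hz => ⟨hz.1, by linarith [hz.2.1], hz.2.2⟩
  set g := U.indicator f
  have hg : Measurable g := hf.indicator hUm
  set ν := volume.withDensity g with hνdef
  have hν : ν = μ.restrict U := withDensity_indicator_eq_restrict hUm
  have hνle : ∀ S, ν S ≤ lam * halfVolume n p (R.L / 8) := fun S => by
    rw [hν]
    calc μ.restrict U S ≤ μ.restrict U univ := measure_mono (subset_univ _)
      _ = μ U := Measure.restrict_apply_univ U
      _ ≤ μ (R.lower p) := measure_mono hUR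
      _ ≤ _ := htot
  set H := U ∩ {z | (halfVolume n p 8 + 1) * lam < f z} with hHdef
  have hHm : MeasurableSet H := hUm.inter (measurableSet_lt measurable_const hf)
  -- `A` is the box around `z`, `P` its neighbour in the past, of twice the side length, and `V`
  -- contains both
  have hHfin : volume H ≠ ∞ := by
    refine ne_top_of_le_ne_top (halfVolume_ne_top (n := n) (p := p) R.L) ?_
    rw [← volume_lower (p := p) R]
    exact measure_mono (inter_subset_left.trans hUR)
  let A : SpaceTime n → ℝ → Set (SpaceTime n) := fun z s =>
    cube (innerCenter R.x R.L z.1 s) s ×ˢ Ioo (z.2 - s ^ p) (z.2 + s ^ p)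
  let V : SpaceTime n → ℝ → Set (SpaceTime n) := fun z s =>
    cube (innerCenter R.x R.L z.1 (2 * s)) (2 * s) ×ˢ
      Ioo (z.2 - s ^ p - (2 * s) ^ p) (z.2 + s ^ p)
  let P : SpaceTime n → ℝ → Set (SpaceTime n) := fun z s =>
    cube (innerCenter R.x R.L z.1 (2 * s)) (2 * s) ×ˢ
      Ioo (z.2 - s ^ p - (2 * s) ^ p) (z.2 - s ^ p)
  have hVm : ∀ z s, MeasurableSet (V z s) := fun z s => measurableSet_box _ _ _ _
  have hPm : ∀ z s, MeasurableSet (P z s) := fun z s => measurableSet_box _ _ _ _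
  have hPV : ∀ z s, 0 < s → P z s ⊆ V z s := fun z s hs y hy => by
    have : 0 < s ^ p := by positivity
    exact ⟨hy.1, hy.2.1, by linarith [hy.2.2]⟩
  have hPvol : ∀ z s, 0 < s → volume (P z s) = halfVolume n p (2 * s) := fun z s hs => by
    simp only [P]
    rw [volume_box _ (by positivity), halfVolume_eq (by positivity)]
    congr 2
    ring
  have h2p : ∀ s : ℝ, 0 < s → s ^ p + s ^ p ≤ (2 * s) ^ p := fun s hs => by
    rw [two_mul]
    exact rpow_add_rpow_le_rpow_add hp hs.le hs.le
  have hVP : ∀ z s, 0 < s → volume (V z s) ≤ 2 * volume (P z s) := fun z s hs => by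
    simp only [V, P]
    rw [volume_box _ (by positivity), volume_box _ (by positivity), mul_left_comm]
    gcongr
    rw [← ENNReal.ofReal_ofNat, ← ENNReal.ofReal_mul zero_le_two]
    refine ENNReal.ofReal_le_ofReal ?_
    linarith [h2p s hs]
  obtain ⟨J, hJH, s, hJc, hJd, hJs, hJ⟩ := exists_stopping_family (p := p) hg (H := H) (A := A)
    (V := V) (V' := fun z s => A z (16 * s)) (Λ := R.L / 8) (lam := lam)
    (c := halfVolume n p 8 * lam) (κ := (halfVolume n p 8 + 1) * lam) (by positivity)
    (ENNReal.mul_lt_mul_left hlam0 hlam (ENNReal.lt_add_right (halfVolume_ne_top _) one_ne_zero))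
    hHfin (fun z hz => by rw [show g z = f z from indicator_of_mem hz.1 f]; exact hz.2) hVm
    (fun z s hs => ((halfVolume_pos (by positivity)).trans_eq (hPvol z s hs).symm).trans_le
      (measure_mono (hPV z s hs)))
    (by
      intro z hz O hO hzO
      obtain ⟨ε, hε, h⟩ := exists_pos_box_subset_of_isOpen hO hzO
      refine ⟨min (ε / 3) (1 / 3), by positivity, fun s hs hsε y hy => ?_⟩
      have hs1 : s ≤ ε / 3 := hsε.trans (min_le_left _ _)
      have hs3 : s ≤ 1 / 3 := hsε.trans (min_le_right _ _)
      have hsp : s ^ p ≤ s := by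
        simpa using Real.rpow_le_rpow_of_exponent_ge hs (by linarith) hp
      have hsp2 : (2 * s) ^ p ≤ 2 * s := by
        simpa using Real.rpow_le_rpow_of_exponent_ge (show 0 < 2 * s by positivity)
          (by linarith) hp
      refine h y (fun i => (abs_sub_le_of_mem_innerCube (by positivity) (hUR hz.1).1 hy.1 i).trans
        (by linarith)) ?_
      rw [abs_le]
      constructor <;> linarith [hy.2.1, hy.2.2])
    (by
      rintro z hz z' hz' s s' hs hs' hss ⟨y, hy, hy'⟩
      have a1 : s ^ p ≤ (2 * s') ^ p := Real.rpow_le_rpow hs.le hss hp0.le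
      have a2 : (2 * s) ^ p ≤ (4 * s') ^ p :=
        Real.rpow_le_rpow (by positivity) (by linarith) hp0.le
      have a3 := rpow_add_rpow_le_rpow_add hp (a := 2 * s') (b := 4 * s')
        (by positivity) (by positivity)
      have a4 := rpow_add_rpow_le_rpow_add hp (a := s') (b := 2 * s')
        (by positivity) (by positivity)
      have a5 := rpow_add_rpow_le_rpow_add hp (a := 2 * s' + 4 * s') (b := s' + 2 * s')
        (by positivity) (by positivity)
      have a6 : (2 * s' + 4 * s' + (s' + 2 * s')) ^ p ≤ (16 * s') ^ p :=
        Real.rpow_le_rpow (by positivity) (by linarith) hp0.le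
      have b1 : 0 < (2 * s) ^ p := by positivity
      have b2 : 0 < (2 * s') ^ p := by positivity
      refine ⟨mem_innerCube hz.1.1 fun i => ?_, ?_, ?_⟩
      · have h1 := abs_le.1 (abs_sub_le_of_mem_innerCube (by positivity) hz.1.1 hy.1 i)
        have h2 := abs_le.1 (abs_sub_le_of_mem_innerCube (by positivity) hz'.1.1 hy'.1 i)
        rw [abs_le]
        constructor <;> linarith
      · linarith [hy.2.2, hy'.2.1]
      · linarith [hy.2.1, hy'.2.2])
    (by
      intro z hz s hs hsΛ hbd
      calc ν (A z (16 * s)) ≤ lam * halfVolume n p (16 * s) :=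
            hbd (16 * s) (by linarith) (by linarith)
        _ = halfVolume n p 8 * lam * volume (P z s) := by
            rw [hPvol z s hs, show 16 * s = 8 * (2 * s) by ring,
              halfVolume_mul (by norm_num) (by positivity)]
            ring
        _ ≤ _ := by gcongr; exact hPV z s hs)
    (fun z hz s hs _ => (hνle _).trans (by gcongr; exact halfVolume_mono hp (by positivity) hs))
  refine ⟨⋃ z ∈ J, P z (s z), ?_, MeasurableSet.biUnion hJc fun z _ => hPm _ _, ?_, ?_⟩
  · refine iUnion₂_subset fun z hz y hy => ?_
    obtain ⟨hs0, hsΛ, -, -⟩ := hJs z hz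
    have hzU := (hJH hz).1
    have a1 := rpow_add_rpow_le_rpow_add hp hs0.le (show 0 ≤ 2 * s z by positivity)
    have a2 : (s z + 2 * s z) ^ p ≤ (3 / 8 * R.L) ^ p :=
      Real.rpow_le_rpow (by positivity) (by linarith) hp0.le
    have a3 : (3 / 8 * R.L) ^ p ≤ 3 / 8 * R.L ^ p := by
      rw [Real.mul_rpow (by norm_num) hL.le]
      gcongr
      simpa using Real.rpow_le_rpow_of_exponent_ge (show (0 : ℝ) < 3 / 8 by norm_num)
        (by norm_num) hp
    have a4 : 0 < s z ^ p := by positivity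
    exact ⟨innerCube_subset (by linarith) hy.1, by linarith [hy.2.1, hzU.2.1],
      by linarith [hy.2.2, hzU.2.2]⟩
  · intro y hy
    obtain ⟨z, hz, hyP⟩ := mem_iUnion₂.1 hy
    obtain ⟨hs0, hsΛ, hlt, -⟩ := hJs z hz
    let T : Rectangle n :=
      ⟨innerCenter R.x R.L z.1 (2 * s z), z.2 - s z ^ p, 2 * s z, by positivity⟩
    refine le_trans ?_ (le_forwardMaximal _ (R := T) hyP)
    have hAT : A z (s z) ⊆ T.upper p := fun x hx => by
      refine ⟨innerCube_mono (by linarith) hx.1, hx.2.1, ?_⟩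
      simp only [T]
      linarith [hx.2.2, h2p (s z) hs0]
    have h1 : lam * halfVolume n p (s z) ≤ μ.restrict (R.lower p) (T.upper p) := by
      refine hlt.le.trans ((measure_mono hAT).trans ?_)
      change ν _ ≤ _
      rw [hν]
      exact Measure.restrict_mono hUR le_rfl _
    calc lam / halfVolume n p 2 = lam * halfVolume n p (s z) / halfVolume n p T.L := by
          rw [show T.L = 2 * s z from rfl, halfVolume_mul zero_le_two hs0.le,
            ENNReal.mul_div_mul_right _ _ (halfVolume_pos hs0).ne' (halfVolume_ne_top _)]
      _ ≤ _ := ENNReal.div_le_div_right h1 _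
  · calc μ H = ν H := by
          rw [hν, Measure.restrict_apply hHm, inter_eq_self_of_subset_left inter_subset_left]
      _ ≤ halfVolume n p 8 * lam * volume (⋃ z ∈ J, V z (s z)) := hJ
      _ = halfVolume n p 8 * lam * ∑' z : J, volume (V z (s z)) := by
          rw [measure_biUnion hJc hJd fun z _ => hVm _ _]
      _ ≤ halfVolume n p 8 * lam * ∑' z : J, 2 * volume (P z (s z)) := by
          gcongr with z
          exact hVP z _ (hJs z z.2).1
      _ = 2 * halfVolume n p 8 * (lam * volume (⋃ z ∈ J, P z (s z))) := by
          rw [measure_biUnion hJc (fun a ha b hb hab => (hJd ha hb hab).mono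
            (hPV _ _ (hJs a ha).1) (hPV _ _ (hJs b hb).1)) fun z _ => hPm _ _,
            ENNReal.tsum_mul_left]
          ring

theorem sum_two_pow_mul_le {S : Finset ℕ} {a x : ℝ≥0∞} (h : ∀ k ∈ S, 2 ^ k * a ≤ x) :
    ∑ k ∈ S, 2 ^ k * a ≤ 2 * x := by
  rcases S.eq_empty_or_nonempty with rfl | hS
  · simp
  have h1 : ∑ k ∈ S, 2 ^ k ≤ 2 ^ (S.max' hS + 1) :=
    (Nat.geomSum_lt le_rfl fun k hk => Nat.lt_succ_of_le (S.le_max' k hk)).le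
  have h2 : (∑ k ∈ S, 2 ^ k : ℝ≥0∞) ≤ 2 ^ (S.max' hS + 1) := by exact_mod_cast h1
  calc ∑ k ∈ S, 2 ^ k * a = (∑ k ∈ S, 2 ^ k) * a := by rw [Finset.sum_mul]
    _ ≤ 2 ^ (S.max' hS + 1) * a := by gcongr
    _ = 2 * (2 ^ (S.max' hS) * a) := by rw [pow_succ]; ring
    _ ≤ 2 * x := by gcongr; exact h _ (S.max'_mem hS)

/-- Summing the reverse weak type estimate over `m` dyadic levels bounds `m` times the mass of the
highest superlevel set by the integral of the maximal function. -/
theorem mul_measure_superlevel_le (hp : 1 ≤ p) {f : SpaceTime n → ℝ≥0∞} (hf : Measurable f)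
    (R : Rectangle n) {lam : ℝ≥0∞} (hlam0 : lam ≠ 0) (hlam : lam ≠ ∞)
    (htot : volume.withDensity f (R.lower p) ≤ lam * halfVolume n p (R.L / 8)) (m : ℕ) :
    m * volume.withDensity f
        (latePart p R ∩ {z | (halfVolume n p 8 + 1) * (2 ^ m * lam) < f z})
      ≤ 4 * halfVolume n p 8 * halfVolume n p 2 *
        ∫⁻ z in R.lower p, forwardMaximal p ((volume.withDensity f).restrict (R.lower p)) z := by
  set μ := volume.withDensity f
  have h2pos : halfVolume n p 2 ≠ 0 := (halfVolume_pos two_pos).ne'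
  have hex : ∀ k : ℕ, _ := fun k => exists_forwardMaximal_ge hp hf R (lam := 2 ^ k * lam)
    (mul_ne_zero (by simp) hlam0) (ENNReal.mul_ne_top (by simp) hlam)
    (htot.trans (by
      gcongr
      exact le_mul_of_one_le_left' (one_le_pow₀ (by norm_num))))
  choose F hFR hFm hFle hF using hex
  set a := lam / halfVolume n p 2
  have hpt : ∀ z, ∑ k ∈ Finset.range m, (F k).indicator (fun _ => 2 ^ k * a) z
      ≤ 2 * forwardMaximal p (μ.restrict (R.lower p)) z := by
    intro z
    classical
    calc ∑ k ∈ Finset.range m, (F k).indicator (fun _ => 2 ^ k * a) z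
        = ∑ k ∈ (Finset.range m).filter (fun k => z ∈ F k), 2 ^ k * a := by
          rw [Finset.sum_filter]
          rfl
      _ ≤ _ := sum_two_pow_mul_le fun k hk => by
          refine le_trans (le_of_eq ?_) (hFle k z (Finset.mem_filter.1 hk).2)
          simp only [a]
          rw [mul_div_assoc]
  calc m * μ (latePart p R ∩ {z | (halfVolume n p 8 + 1) * (2 ^ m * lam) < f z})
      = ∑ k ∈ Finset.range m,
          μ (latePart p R ∩ {z | (halfVolume n p 8 + 1) * (2 ^ m * lam) < f z}) := by simp
    _ ≤ ∑ k ∈ Finset.range m, 2 * halfVolume n p 8 * (2 ^ k * lam * volume (F k)) := by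
        refine Finset.sum_le_sum fun k hk => le_trans (measure_mono ?_) (hF k)
        refine inter_subset_inter_right _ fun z hz => ?_
        refine lt_of_le_of_lt ?_ (show (halfVolume n p 8 + 1) * (2 ^ m * lam) < f z from hz)
        gcongr
        · norm_num
        · exact (Finset.mem_range.1 hk).le
    _ = 2 * halfVolume n p 8 * halfVolume n p 2 *
          ∑ k ∈ Finset.range m, 2 ^ k * a * volume (F k) := by
        rw [Finset.mul_sum]
        refine Finset.sum_congr rfl fun k _ => ?_
        have : lam = a * halfVolume n p 2 :=
          (ENNReal.div_mul_cancel h2pos (halfVolume_ne_top _)).symm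
        rw [this]
        ring
    _ = 2 * halfVolume n p 8 * halfVolume n p 2 * ∫⁻ z in R.lower p,
          ∑ k ∈ Finset.range m, (F k).indicator (fun _ => 2 ^ k * a) z := by
        rw [lintegral_finsetSum _ fun k _ => measurable_const.indicator (hFm k)]
        congr 1
        refine Finset.sum_congr rfl fun k _ => ?_
        rw [lintegral_indicator_const (hFm k), Measure.restrict_apply (hFm k),
          inter_eq_self_of_subset_left (hFR k)]
    _ ≤ 2 * halfVolume n p 8 * halfVolume n p 2 * ∫⁻ z in R.lower p,
          2 * forwardMaximal p (μ.restrict (R.lower p)) z := by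
        gcongr with z
        exact hpt z
    _ = _ := by
        rw [lintegral_const_mul' _ _ (by norm_num)]
        ring

/-- The maximal function condition makes the mass of the superlevel sets in `R⁻` uniformly small
compared with the mass of `R⁺`. -/
theorem exists_superlevel_small_of_forwardMaximal (hp : 1 ≤ p) {f : SpaceTime n → ℝ≥0∞}
    (hf : Measurable f) (hfin : ∀ R : Rectangle n, volume.withDensity f (R.upper p) ≠ ∞)
    {C : ℝ≥0∞} (hC : C ≠ ∞)
    (hM : ∀ R : Rectangle n,
      ∫⁻ z in R.lower p, forwardMaximal p ((volume.withDensity f).restrict (R.lower p)) z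
        ≤ C * volume.withDensity f (R.upper p)) :
    ∃ G : ℝ≥0∞, G ≠ ∞ ∧ ∀ m : ℕ, ∃ B : ℝ≥0∞, B ≠ ∞ ∧ ∀ R : Rectangle n,
      m * volume.withDensity f (R.lower p ∩
          {z | B * (volume.withDensity f (R.upper p) / halfVolume n p R.L) < f z})
        ≤ G * volume.withDensity f (R.upper p) := by
  set μ := volume.withDensity f
  obtain ⟨D, hDtop, hD⟩ := exists_doubling_of_forwardMaximal hC hM
  set c := 4 * halfVolume n p 8 * halfVolume n p 2 * C
  have hc : c ≠ ∞ := by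
    simp [c, ENNReal.mul_eq_top, hC, halfVolume_ne_top]
  set b := (D + 1) * halfVolume n p 8
  have hb : b ≠ ∞ := by simp [b, ENNReal.mul_eq_top, hDtop, halfVolume_ne_top]
  have hb0 : b ≠ 0 := by
    simp [b, (halfVolume_pos (n := n) (p := p) (show (0 : ℝ) < 8 by norm_num)).ne']
  have hlate : ∀ (m : ℕ) (R : Rectangle n), μ (R.upper p) ≠ 0 →
      m * μ (latePart p R ∩ {z | (halfVolume n p 8 + 1) *
        (2 ^ m * (b * (μ (R.upper p) / halfVolume n p R.L))) < f z}) ≤ c * μ (R.upper p) := by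
    intro m R hR0
    have hVL := halfVolume_pos (n := n) (p := p) R.L_pos
    have havg0 : μ (R.upper p) / halfVolume n p R.L ≠ 0 :=
      (ENNReal.div_pos hR0 (halfVolume_ne_top _)).ne'
    have havgtop : μ (R.upper p) / halfVolume n p R.L ≠ ∞ := ENNReal.div_ne_top (hfin R) hVL.ne'
    refine (mul_measure_superlevel_le hp hf R (mul_ne_zero hb0 havg0)
      (ENNReal.mul_ne_top hb havgtop) ?_ m).trans ?_
    · calc μ (R.lower p) ≤ D * μ (R.upper p) := hD R
        _ ≤ (D + 1) * μ (R.upper p) := by gcongr; exact le_self_add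
        _ = (D + 1) * (μ (R.upper p) / halfVolume n p R.L *
              (halfVolume n p 8 * halfVolume n p (R.L / 8))) := by
            rw [← halfVolume_mul (by norm_num) (by linarith [R.L_pos]),
              mul_div_cancel₀ _ (by norm_num : (8 : ℝ) ≠ 0),
              ENNReal.div_mul_cancel hVL.ne' (halfVolume_ne_top _)]
        _ = _ := by simp only [b]; ring
    · calc _ ≤ 4 * halfVolume n p 8 * halfVolume n p 2 * (C * μ (R.upper p)) := by
            gcongr; exact hM R
        _ = _ := by simp only [c]; ring
  refine ⟨c * (2 * C + 1) + c, ?_, fun m =>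
    ⟨(halfVolume n p 8 + 1) * (2 ^ m * (b * (2 * C + 1))), ?_, fun R => ?_⟩⟩
  · simp [ENNReal.mul_eq_top, hc, hC]
  · simp [ENNReal.mul_eq_top, hb, hC, halfVolume_ne_top]
  by_cases hR0 : μ (R.upper p) = 0
  · have : μ (R.lower p) = 0 :=
      nonpos_iff_eq_zero.1 ((hD R).trans_eq (mul_eq_zero_of_right D hR0))
    rw [measure_mono_null inter_subset_left this, mul_zero]
    exact zero_le
  set T := {z | (halfVolume n p 8 + 1) * (2 ^ m * (b * (2 * C + 1))) *
    (μ (R.upper p) / halfVolume n p R.L) < f z} with hT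
  have hLp : 0 < R.L ^ p := Real.rpow_pos_of_pos R.L_pos p
  have hsub : R.lower p ∩ T ⊆ (latePart p (shiftDown p R) ∩ T) ∪ (latePart p R ∩ T) := by
    rintro z ⟨hz, hzT⟩
    rcases lt_or_ge z.2 (R.t - R.L ^ p / 2) with h | h
    · refine Or.inl ⟨⟨hz.1, ?_, h⟩, hzT⟩
      simp only [shiftDown]
      linarith [hz.2.1]
    · exact Or.inr ⟨⟨hz.1, by linarith, hz.2.2⟩, hzT⟩
  have hshift := measure_upper_shiftDown_le hM R
  have h1 : m * μ (latePart p (shiftDown p R) ∩ T) ≤ c * ((2 * C + 1) * μ (R.upper p)) := by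
    by_cases hS0 : μ ((shiftDown p R).upper p) = 0
    · have h0 : μ ((shiftDown p R).lower p) = 0 :=
        nonpos_iff_eq_zero.1 ((hD _).trans_eq (mul_eq_zero_of_right D hS0))
      have h2 : latePart p (shiftDown p R) ⊆ (shiftDown p R).lower p := fun z hz =>
        ⟨hz.1, by
          have : (shiftDown p R).L ^ p = R.L ^ p := rfl
          linarith [hz.2.1], hz.2.2⟩
      rw [measure_mono_null (inter_subset_left.trans h2) h0, mul_zero]
      exact zero_le
    refine le_trans ?_ ((hlate m (shiftDown p R) hS0).trans (by gcongr))
    gcongr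
    intro z hz
    refine lt_of_le_of_lt ?_ (show _ < f z from hz)
    calc (halfVolume n p 8 + 1) * (2 ^ m * (b * (μ ((shiftDown p R).upper p) /
            halfVolume n p (shiftDown p R).L)))
        ≤ (halfVolume n p 8 + 1) * (2 ^ m * (b * ((2 * C + 1) * μ (R.upper p) /
            halfVolume n p R.L))) := by
          gcongr
          exact le_rfl
      _ = _ := by rw [mul_div_assoc]; ring
  have h2 : m * μ (latePart p R ∩ T) ≤ c * μ (R.upper p) := by
    refine le_trans ?_ (hlate m R hR0)
    gcongr
    intro z hz
    refine lt_of_le_of_lt ?_ (show _ < f z from hz)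
    calc (halfVolume n p 8 + 1) * (2 ^ m * (b * (μ (R.upper p) / halfVolume n p R.L)))
        ≤ (2 * C + 1) *
          ((halfVolume n p 8 + 1) * (2 ^ m * (b * (μ (R.upper p) / halfVolume n p R.L)))) :=
          le_mul_of_one_le_left' le_add_self
      _ = _ := by ring
  calc m * μ (R.lower p ∩ T)
      ≤ m * (μ (latePart p (shiftDown p R) ∩ T) + μ (latePart p R ∩ T)) := by
        gcongr
        exact (measure_mono hsub).trans (measure_union_le _ _)
    _ = m * μ (latePart p (shiftDown p R) ∩ T) + m * μ (latePart p R ∩ T) := mul_add _ _ _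
    _ ≤ c * ((2 * C + 1) * μ (R.upper p)) + c * μ (R.upper p) := add_le_add h1 h2
    _ = _ := by ring

end MaximalLower

/-! ### The measurable density of a weight -/

section Bridge

variable {n : ℕ} {p : ℝ} {w : SpaceTime n → ℝ} {f : SpaceTime n → ℝ≥0∞}

/-- A weight is only almost everywhere equal to a measurable function; all the conditions depend
on the almost everywhere class alone. -/
theorem exists_measurable_density (hw : IsWeight w) :
    ∃ f : SpaceTime n → ℝ≥0∞, Measurable f ∧ (∀ z, f z ≠ ∞) ∧
      (fun z => ENNReal.ofReal (w z)) =ᵐ[volume] f := by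
  have h := hw.1.aestronglyMeasurable
  refine ⟨fun z => ENNReal.ofReal (h.mk w z), h.stronglyMeasurable_mk.measurable.ennreal_ofReal,
    fun z => ENNReal.ofReal_ne_top, ?_⟩
  filter_upwards [h.ae_eq_mk] with z hz
  rw [hz]

theorem mass_eq (hfw : (fun z => ENNReal.ofReal (w z)) =ᵐ[volume] f) (A : Set (SpaceTime n)) :
    mass w A = volume.withDensity f A := by
  rw [mass, withDensity_apply']
  exact lintegral_congr_ae (ae_restrict_of_ae hfw)

theorem avg_upper_eq (hfw : (fun z => ENNReal.ofReal (w z)) =ᵐ[volume] f) (R : Rectangle n) :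
    avg w (R.upper p) = volume.withDensity f (R.upper p) / halfVolume n p R.L := by
  rw [avg, setLAverage_eq, volume_upper, ← mass_eq hfw]
  rfl

theorem measure_box_ne_top (hw : IsWeight w)
    (hfw : (fun z => ENNReal.ofReal (w z)) =ᵐ[volume] f) (x : Fin n → ℝ) {L : ℝ} (hL : 0 ≤ L)
    (a b : ℝ) : volume.withDensity f (cube x L ×ˢ Ioo a b) ≠ ∞ := by
  have hK : IsCompact (cube x L ×ˢ Icc a b : Set (SpaceTime n)) := by
    rw [cube_eq_closedBall x hL]
    exact (isCompact_closedBall _ _).prod isCompact_Icc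
  have h := (hw.1.integrableOn_isCompact hK).lintegral_lt_top
  refine ne_top_of_le_ne_top h.ne ?_
  rw [← mass_eq hfw]
  exact lintegral_mono_set (prod_mono_right Ioo_subset_Icc_self)

theorem maximalPlus_eq (hw : IsWeight w)
    (hfw : (fun z => ENNReal.ofReal (w z)) =ᵐ[volume] f) (S : Set (SpaceTime n))
    (hS : MeasurableSet S) (z : SpaceTime n) :
    maximalPlus p (S.indicator w) z = forwardMaximal p ((volume.withDensity f).restrict S) z := by
  unfold maximalPlus forwardMaximal
  refine iSup_congr fun T => iSup_congr fun _ => ?_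
  rw [avg, setLAverage_eq, volume_upper, ← withDensity_indicator_eq_restrict hS,
    withDensity_apply _ (measurableSet_upper T)]
  congr 1
  refine lintegral_congr_ae (ae_restrict_of_ae ?_)
  filter_upwards [hfw] with y hy
  by_cases hyS : y ∈ S
  · rw [indicator_of_mem hyS, indicator_of_mem hyS, abs_of_nonneg (hw.2 y), ← hy]
  · rw [indicator_of_notMem hyS, indicator_of_notMem hyS, abs_zero, ENNReal.ofReal_zero]

theorem mass_superlevel_eq (hfw : (fun z => ENNReal.ofReal (w z)) =ᵐ[volume] f)
    {α : ℝ} (hα : 0 ≤ α) (t : ℝ≥0∞) (A : Set (SpaceTime n)) :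
    mass w (A ∩ {z | t < ENNReal.ofReal (α * w z)})
      = volume.withDensity f (A ∩ {z | t < ENNReal.ofReal α * f z}) := by
  rw [mass_eq hfw]
  refine measure_congr ((withDensity_absolutelyContinuous volume f).ae_le ?_)
  filter_upwards [hfw] with z hz
  refine propext (and_congr_right fun _ => ?_)
  change t < ENNReal.ofReal (α * w z) ↔ t < ENNReal.ofReal α * f z
  rw [ENNReal.ofReal_mul hα, ← hz]

theorem strictBound_of_le_mul {a b c : ℝ≥0∞} {β : ℝ} (h : a ≤ c * b)
    (hc : c < ENNReal.ofReal β) (hb : b ≠ ∞) : StrictBound a β b := by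
  rcases eq_or_ne b 0 with h0 | h0
  · exact Or.inr ⟨nonpos_iff_eq_zero.1 (h.trans_eq (mul_eq_zero_of_right c h0)), h0⟩
  · exact Or.inl (h.trans_lt (ENNReal.mul_lt_mul_left h0 hb hc))

theorem StrictBound.le {a b : ℝ≥0∞} {β : ℝ} (h : StrictBound a β b) : a ≤ ENNReal.ofReal β * b := by
  rcases h with h | ⟨rfl, -⟩
  · exact h.le
  · exact zero_le

theorem setLIntegral_rpow_eq_zero {q : ℝ} (hq : 0 < q) (hf : Measurable f)
    {A : Set (SpaceTime n)} (hA : MeasurableSet A) :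
    ∫⁻ z in A, f z ^ q = 0 ↔ volume.withDensity f A = 0 := by
  rw [withDensity_apply _ hA, lintegral_eq_zero_iff (hf.pow_const q), lintegral_eq_zero_iff hf]
  refine Filter.eventually_congr (Filter.Eventually.of_forall fun z => ?_)
  simp [ENNReal.rpow_eq_zero_iff, hq, hq.le]

/-- The reverse Hölder condition without averages and roots. -/
theorem memRHPlus_iff (hfw : (fun z => ENNReal.ofReal (w z)) =ᵐ[volume] f)
    {q : ℝ} (hq : 0 < q) :
    MemRHPlus p q w ↔ ∃ C : ℝ≥0∞, C ≠ ∞ ∧ ∀ R : Rectangle n, ∫⁻ z in R.lower p, f z ^ q ≤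
      C * (volume.withDensity f (R.upper p) / halfVolume n p R.L) ^ q * halfVolume n p R.L := by
  have key : ∀ (c : ℝ≥0∞) (R : Rectangle n),
      (⨍⁻ z in R.lower p, ENNReal.ofReal (w z) ^ q ∂volume) ^ (1 / q) ≤ c * avg w (R.upper p) ↔
      ∫⁻ z in R.lower p, f z ^ q ≤ c ^ q *
        (volume.withDensity f (R.upper p) / halfVolume n p R.L) ^ q * halfVolume n p R.L := by
    intro c R
    have h1 : ∫⁻ z in R.lower p, ENNReal.ofReal (w z) ^ q = ∫⁻ z in R.lower p, f z ^ q := by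
      refine lintegral_congr_ae (ae_restrict_of_ae ?_)
      filter_upwards [hfw] with z hz
      rw [hz]
    rw [setLAverage_eq, volume_lower, h1, avg_upper_eq hfw, one_div, ENNReal.rpow_inv_le_iff hq,
      ENNReal.mul_rpow_of_nonneg _ _ hq.le,
      ENNReal.div_le_iff (halfVolume_pos R.L_pos).ne' (halfVolume_ne_top _)]
  constructor
  · rintro ⟨C, hC⟩
    exact ⟨(C : ℝ≥0∞) ^ q, ENNReal.rpow_ne_top_of_nonneg hq.le ENNReal.coe_ne_top,
      fun R => (key C R).1 (hC R)⟩
  · rintro ⟨C, hCtop, hC⟩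
    have h1 : C ^ q⁻¹ ≠ ∞ := ENNReal.rpow_ne_top_of_nonneg (inv_nonneg.2 hq.le) hCtop
    refine ⟨(C ^ q⁻¹).toNNReal, fun R => (key _ R).2 ?_⟩
    rw [ENNReal.coe_toNNReal h1, ENNReal.rpow_inv_rpow hq.ne']
    exact hC R

end Bridge

/-! ### Implications for the density -/

section Implications

variable {n : ℕ} {p : ℝ} {f : SpaceTime n → ℝ≥0∞}

/-- Hölder's inequality turns a reverse Hölder inequality into a quantitative absolute
continuity. -/
theorem measure_le_of_reverseHolder (hf : Measurable f) {q : ℝ} (hq : 1 < q) {C : ℝ≥0∞}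
    {R : Rectangle n}
    (hC : ∫⁻ z in R.lower p, f z ^ q ≤
      C * (volume.withDensity f (R.upper p) / halfVolume n p R.L) ^ q * halfVolume n p R.L)
    {E : Set (SpaceTime n)} (hE : MeasurableSet E) (hER : E ⊆ R.lower p) :
    volume.withDensity f E ≤ C ^ (1 / q) * (volume E / halfVolume n p R.L) ^ (1 - 1 / q) *
      volume.withDensity f (R.upper p) := by
  have hq0 : 0 < q := by linarith
  have hVL := halfVolume_pos (n := n) (p := p) R.L_pos
  have hVt := halfVolume_ne_top (n := n) (p := p) R.L
  set V := halfVolume n p R.L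
  set A := volume.withDensity f (R.upper p)
  have hd : 0 < 1 - 1 / q := by
    rw [sub_pos, div_lt_one hq0]
    exact hq
  have hconj : q.HolderConjugate (1 / (1 - 1 / q)) := by
    rw [Real.holderConjugate_iff]
    refine ⟨hq, ?_⟩
    rw [one_div, one_div, inv_inv]
    ring
  have h1 := ENNReal.lintegral_mul_le_Lp_mul_Lq (volume.restrict E) hconj hf.aemeasurable
    (g := fun _ => 1) aemeasurable_const
  simp only [Pi.mul_apply, mul_one, ENNReal.one_rpow, lintegral_const, one_mul,
    Measure.restrict_apply MeasurableSet.univ, univ_inter, one_div_one_div] at h1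
  rw [withDensity_apply _ hE]
  refine h1.trans ?_
  calc (∫⁻ z in E, f z ^ q) ^ (1 / q) * volume E ^ (1 - 1 / q)
      ≤ (C * (A / V) ^ q * V) ^ (1 / q) * volume E ^ (1 - 1 / q) := by
        gcongr
        exact (lintegral_mono_set hER).trans hC
    _ = C ^ (1 / q) * ((A / V) * V ^ (1 / q)) * volume E ^ (1 - 1 / q) := by
        rw [ENNReal.mul_rpow_of_nonneg _ _ (by positivity),
          ENNReal.mul_rpow_of_nonneg _ _ (by positivity), ← ENNReal.rpow_mul,
          mul_one_div_cancel hq0.ne', ENNReal.rpow_one]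
        ring
    _ = C ^ (1 / q) * (volume E / V) ^ (1 - 1 / q) * A := by
        have h3 : V ^ (1 / q) = V * (V⁻¹) ^ (1 - 1 / q) := by
          rw [ENNReal.inv_rpow, ← ENNReal.rpow_neg]
          nth_rewrite 2 [← ENNReal.rpow_one V]
          rw [← ENNReal.rpow_add _ _ hVL.ne' hVt]
          congr 1
          ring
        rw [h3, ENNReal.div_eq_inv_mul (a := volume E), ENNReal.mul_rpow_of_nonneg _ _ hd.le,
          ← mul_assoc (A / V), ENNReal.div_mul_cancel hVL.ne' hVt]
        ring

/-- If subsets of `R⁻` of small volume have mass at most `b` times that of `R⁺`, then slicing `R⁻`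
in time bounds its mass. -/
theorem measure_lower_le_of_small {α : ℝ} (hα : 0 < α) {b : ℝ≥0∞} :
    ∃ N : ℕ, ∀ R : Rectangle n, (∀ E : Set (SpaceTime n), MeasurableSet E → E ⊆ R.lower p →
      volume E < ENNReal.ofReal α * halfVolume n p R.L →
        volume.withDensity f E ≤ b * volume.withDensity f (R.upper p)) →
      volume.withDensity f (R.lower p) ≤ N * b * volume.withDensity f (R.upper p) := by
  obtain ⟨N, hN⟩ := exists_nat_gt (1 / α)
  have hN0 : (0 : ℝ) < N := (by positivity : 0 < 1 / α).trans hN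
  refine ⟨N, fun R h => ?_⟩
  have hL := R.L_pos
  have hLp : 0 < R.L ^ p := Real.rpow_pos_of_pos hL p
  set r := R.L ^ p / N with hr
  have hr0 : 0 < r := by positivity
  have hrN : N * r = R.L ^ p := by rw [hr]; field_simp
  set t₀ := R.t - R.L ^ p with ht₀
  let E : ℕ → Set (SpaceTime n) := fun j =>
    R.lower p ∩ {z | t₀ + j * r ≤ z.2 ∧ z.2 < t₀ + (j + 1) * r}
  have hEm : ∀ j, MeasurableSet (E j) := fun j => (measurableSet_lower R).inter
    ((measurableSet_le measurable_const measurable_snd).inter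
      (measurableSet_lt measurable_snd measurable_const))
  have hEvol : ∀ j, volume (E j) < ENNReal.ofReal α * halfVolume n p R.L := by
    intro j
    have hsub : E j ⊆ cube R.x R.L ×ˢ Ico (t₀ + j * r) (t₀ + (j + 1) * r) :=
      fun z hz => ⟨hz.1.1, hz.2⟩
    refine (measure_mono hsub).trans_lt ?_
    rw [Measure.volume_eq_prod, Measure.prod_prod, cube_eq_closedBall _ hL.le,
      Real.volume_pi_closedBall _ (by positivity), Real.volume_Ico, Fintype.card_fin,
      mul_div_cancel₀ _ (two_ne_zero), halfVolume_eq hL, mul_left_comm,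
      show t₀ + (j + 1) * r - (t₀ + j * r) = r by ring, ← ENNReal.ofReal_mul hα.le]
    refine ENNReal.mul_lt_mul_right (by simpa using pow_pos hL n) ENNReal.ofReal_ne_top ?_
    rw [ENNReal.ofReal_lt_ofReal_iff (by positivity), hr, div_lt_iff₀ hN0]
    have : 1 < α * N := by rwa [div_lt_iff₀' hα] at hN
    nlinarith
  have hcov : R.lower p ⊆ ⋃ j ∈ Finset.range N, E j := by
    intro z hz
    have h1 : 0 < z.2 - t₀ := by linarith [hz.2.1]
    have h2 : z.2 - t₀ < N * r := by rw [hrN]; linarith [hz.2.2]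
    have h3 : 0 ≤ (z.2 - t₀) / r := by positivity
    have h4 := Nat.floor_le h3
    have h5 := Nat.lt_floor_add_one ((z.2 - t₀) / r)
    rw [le_div_iff₀ hr0] at h4
    rw [div_lt_iff₀ hr0] at h5
    have h6 : (⌊(z.2 - t₀) / r⌋₊ : ℝ) < N := by nlinarith
    exact mem_biUnion (Finset.mem_coe.2 (Finset.mem_range.2 (by exact_mod_cast h6)))
      ⟨hz, by linarith, by linarith⟩
  calc volume.withDensity f (R.lower p) ≤ volume.withDensity f (⋃ j ∈ Finset.range N, E j) :=
        measure_mono hcov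
    _ ≤ ∑ j ∈ Finset.range N, volume.withDensity f (E j) := measure_biUnion_finset_le _ _
    _ ≤ ∑ j ∈ Finset.range N, b * volume.withDensity f (R.upper p) :=
        Finset.sum_le_sum fun j _ => h _ (hEm j) inter_subset_left (hEvol j)
    _ = _ := by rw [Finset.sum_const, Finset.card_range, nsmul_eq_mul, mul_assoc]

theorem logPlus_mono {a b : ℝ≥0∞} (h : a ≤ b) : logPlus a ≤ logPlus b :=
  EReal.toENNReal_le_toENNReal (ENNReal.log_monotone h)

theorem logPlus_le_rpow {δ : ℝ} (hδ : 0 < δ) (x : ℝ≥0∞) :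
    logPlus x ≤ (ENNReal.ofReal δ)⁻¹ * x ^ δ := by
  rcases eq_or_ne x ∞ with rfl | hx
  · rw [ENNReal.top_rpow_of_pos hδ, ENNReal.mul_top (by simp)]
    exact le_top
  rcases eq_or_ne x 0 with rfl | hx0
  · simp [logPlus]
  lift x to ℝ≥0 using hx
  have hx' : (0 : ℝ) < x := by
    have : x ≠ 0 := by simpa using hx0
    exact_mod_cast this.bot_lt
  have h1 : (x : ℝ≥0∞) = ENNReal.ofReal x := (ENNReal.ofReal_coe_nnreal).symm
  rw [logPlus, h1, ENNReal.log_ofReal_of_pos hx', EReal.toENNReal_of_ne_top (by simp),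
    EReal.toReal_coe, ENNReal.ofReal_rpow_of_pos hx', ← ENNReal.ofReal_inv_of_pos hδ,
    ← ENNReal.ofReal_mul (by positivity)]
  refine ENNReal.ofReal_le_ofReal ?_
  rw [inv_mul_eq_div]
  exact Real.log_le_rpow_div hx'.le hδ

/-- The level set condition implies a reverse Hölder inequality. -/
theorem exists_reverseHolder_of_superlevel (hp : 1 ≤ p) (hf : Measurable f)
    (hftop : ∀ z, f z ≠ ∞) (hfin : ∀ R : Rectangle n, volume.withDensity f (R.upper p) ≠ ∞)
    {α β : ℝ} (hα : 0 < α) (hβ : β < 1 / 2 ^ ((n : ℝ) + p))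
    (h : ∀ R : Rectangle n,
      volume.withDensity f (R.lower p ∩ {z | volume.withDensity f (R.upper p) / halfVolume n p R.L
        < ENNReal.ofReal α * f z}) ≤ ENNReal.ofReal β * volume.withDensity f (R.upper p)) :
    ∃ (q : ℝ) (C : ℝ≥0∞), 1 < q ∧ C ≠ ∞ ∧ ∀ R : Rectangle n, ∫⁻ z in R.lower p, f z ^ q ≤
      C * (volume.withDensity f (R.upper p) / halfVolume n p R.L) ^ q * halfVolume n p R.L := by
  set μ := volume.withDensity f
  set a := (ENNReal.ofReal α)⁻¹ with ha
  set b := ENNReal.ofReal β with hb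
  have hα0 : ENNReal.ofReal α ≠ 0 := by simpa using hα
  have hatop : a ≠ ∞ := ENNReal.inv_ne_top.2 hα0
  have hlevel : ∀ (R : Rectangle n) (t : ℝ≥0∞), μ (R.upper p) ≤ t * halfVolume n p R.L →
      μ (R.lower p ∩ {z | a * t < f z}) ≤ b * t * halfVolume n p R.L := by
    intro R t ht
    calc μ (R.lower p ∩ {z | a * t < f z}) ≤ b * μ (R.upper p) := by
          refine (measure_mono (inter_subset_inter_right _ fun z hz => ?_)).trans (h R)
          have hz : a * t < f z := hz
          refine lt_of_le_of_lt (ENNReal.div_le_of_le_mul ht) ?_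
          rwa [ha, mul_comm, ← ENNReal.div_eq_inv_mul.trans (mul_comm _ _),
            ENNReal.div_lt_iff (Or.inl hα0) (Or.inl ENNReal.ofReal_ne_top), mul_comm] at hz
      _ ≤ b * (t * halfVolume n p R.L) := by gcongr
      _ = _ := by ring
  have hD : ∀ R : Rectangle n, μ (R.lower p) ≤ (a + b) * μ (R.upper p) := by
    intro R
    have hVL := halfVolume_pos (n := n) (p := p) R.L_pos
    set t := μ (R.upper p) / halfVolume n p R.L
    have ht : μ (R.upper p) = t * halfVolume n p R.L :=
      (ENNReal.div_mul_cancel hVL.ne' (halfVolume_ne_top _)).symm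
    calc μ (R.lower p) ≤ μ ((R.lower p ∩ {z | f z ≤ a * t}) ∪ (R.lower p ∩ {z | a * t < f z})) := by
          refine measure_mono fun z hz => ?_
          rcases le_or_gt (f z) (a * t) with h | h
          · exact Or.inl ⟨hz, h⟩
          · exact Or.inr ⟨hz, h⟩
      _ ≤ a * t * halfVolume n p R.L + b * t * halfVolume n p R.L := by
          refine (measure_union_le _ _).trans (add_le_add ?_ (hlevel R t ht.le))
          rw [← volume_lower (p := p) R]
          exact measure_inter_le_mul_volume hf (measurableSet_lower R) _
      _ = (a + b) * μ (R.upper p) := by rw [ht]; ring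
  have hDtop : a + b ≠ ∞ := ENNReal.add_ne_top.2 ⟨hatop, ENNReal.ofReal_ne_top⟩
  have hb2 : b * halfVolume n p 2 < 1 := by
    rw [hb, halfVolume, ← ENNReal.ofReal_mul' (by positivity), ENNReal.ofReal_lt_one]
    rwa [lt_div_iff₀ (by positivity)] at hβ
  obtain ⟨A, M, ρ, hA0, hAtop, hM, hMtop, hρ, hdecay⟩ :=
    exists_geometric_decay hp hf hDtop hatop hD hlevel hb2
  obtain ⟨δ, C, hδ, hC, hRH⟩ :=
    exists_reverseHolder_of_decay hf hftop hDtop hD hA0 hAtop hM hMtop hρ hdecay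
  refine ⟨1 + δ, C, by linarith, hC, fun R => ?_⟩
  by_cases hR0 : μ (R.upper p) = 0
  · have h0 : μ (R.lower p) = 0 :=
      nonpos_iff_eq_zero.1 ((hD R).trans_eq (mul_eq_zero_of_right _ hR0))
    rw [(setLIntegral_rpow_eq_zero (by linarith) hf (measurableSet_lower R)).2 h0]
    exact zero_le
  · exact hRH R hR0 (hfin R)

end Implications

/-! ### The equivalent conditions -/

section Equivalences

variable {n : ℕ} {p : ℝ} {w : SpaceTime n → ℝ} {f : SpaceTime n → ℝ≥0∞}

theorem div_measure_le_of_reverseHolder (hf : Measurable f)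
    (hfw : (fun z => ENNReal.ofReal (w z)) =ᵐ[volume] f) {q : ℝ} (hq : 1 < q)
    (h : MemRHPlus p q w) :
    ∃ (C : ℝ≥0) (δ : ℝ), 0 < C ∧ 0 < δ ∧ ∀ (R : Rectangle n) (E : Set (SpaceTime n)),
      MeasurableSet E → E ⊆ R.lower p →
        mass w E / mass w (R.upper p) ≤ C * (volume E / volume (R.lower p)) ^ δ := by
  have hq0 : 0 < q := by linarith
  obtain ⟨C, hCtop, hC⟩ := (memRHPlus_iff hfw hq0).1 h
  have h1 : C ^ (1 / q) ≠ ∞ := ENNReal.rpow_ne_top_of_nonneg (by positivity) hCtop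
  refine ⟨(C ^ (1 / q)).toNNReal + 1, 1 - 1 / q, by positivity, ?_, fun R E hE hER => ?_⟩
  · rw [sub_pos, div_lt_one hq0]
    exact hq
  refine ENNReal.div_le_of_le_mul ?_
  rw [mass_eq hfw, mass_eq hfw, volume_lower]
  refine (measure_le_of_reverseHolder hf hq (hC R) hE hER).trans ?_
  gcongr
  push_cast
  rw [ENNReal.coe_toNNReal h1]
  exact le_self_add

theorem strictBound_of_div_le {C : ℝ≥0} {δ : ℝ} (hC : 0 < C) (hδ : 0 < δ)
    (hfin : ∀ R : Rectangle n, mass w (R.upper p) ≠ ∞)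
    (h : ∀ (R : Rectangle n) (E : Set (SpaceTime n)), MeasurableSet E → E ⊆ R.lower p →
      mass w E / mass w (R.upper p) ≤ C * (volume E / volume (R.lower p)) ^ δ)
    {β : ℝ} (hβ : 0 < β) :
    ∃ α : ℝ, 0 < α ∧ α < 1 ∧
      ∀ (R : Rectangle n) (E : Set (SpaceTime n)), MeasurableSet E → E ⊆ R.lower p →
        volume E < ENNReal.ofReal α * volume (R.lower p) →
          StrictBound (mass w E) β (mass w (R.upper p)) := by
  have hC' : (0 : ℝ) < C := hC
  set α := min (1 / 2) ((β / (2 * C)) ^ (1 / δ)) with hα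
  have hα0 : 0 < α := lt_min (by norm_num) (by positivity)
  have hαδ : C * α ^ δ ≤ β / 2 := by
    have h1 : α ^ δ ≤ ((β / (2 * C)) ^ (1 / δ)) ^ δ :=
      Real.rpow_le_rpow hα0.le (min_le_right _ _) hδ.le
    rw [← Real.rpow_mul (by positivity), one_div_mul_cancel hδ.ne', Real.rpow_one] at h1
    calc C * α ^ δ ≤ C * (β / (2 * C)) := by gcongr
      _ = β / 2 := by field_simp
  refine ⟨α, hα0, (min_le_left _ _).trans_lt (by norm_num), fun R E hE hER hvol => ?_⟩
  have hVL := halfVolume_pos (n := n) (p := p) R.L_pos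
  have h1 : mass w E / mass w (R.upper p) ≤ ENNReal.ofReal (β / 2) := by
    refine (h R E hE hER).trans ?_
    calc C * (volume E / volume (R.lower p)) ^ δ ≤ C * ENNReal.ofReal α ^ δ := by
          gcongr
          rw [ENNReal.div_le_iff (by rw [volume_lower]; exact hVL.ne')
            (by rw [volume_lower]; exact halfVolume_ne_top _)]
          exact hvol.le
      _ = ENNReal.ofReal (C * α ^ δ) := by
          rw [ENNReal.ofReal_rpow_of_pos hα0, ENNReal.ofReal_mul hC'.le, ENNReal.ofReal_coe_nnreal]
      _ ≤ _ := ENNReal.ofReal_le_ofReal hαδ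
  refine strictBound_of_le_mul (c := ENNReal.ofReal (β / 2)) ?_
    ((ENNReal.ofReal_lt_ofReal_iff hβ).2 (by linarith)) (hfin R)
  -- a vanishing denominator forces a vanishing numerator, since `a / 0 = ∞` for `a > 0`
  rcases eq_or_ne (mass w (R.upper p)) 0 with h0 | h0
  · have : mass w E = 0 := by
      by_contra hne
      rw [h0, ENNReal.div_zero hne] at h1
      exact ENNReal.ofReal_ne_top (top_unique h1)
    rw [this]
    exact zero_le
  · exact (ENNReal.div_le_iff h0 (hfin R)).1 h1

/-- Subsets of small volume have small mass; in particular this applies to superlevel sets, whose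
volume Chebyshev's inequality controls. -/
theorem strictBound_superlevel_of_small (hf : Measurable f)
    (hfw : (fun z => ENNReal.ofReal (w z)) =ᵐ[volume] f)
    (hfin : ∀ R : Rectangle n, mass w (R.upper p) ≠ ∞) {α β : ℝ} (hα : 0 < α) (hα1 : α < 1)
    (hβ : 0 < β)
    (h : ∀ (R : Rectangle n) (E : Set (SpaceTime n)), MeasurableSet E → E ⊆ R.lower p →
      volume E < ENNReal.ofReal α * volume (R.lower p) →
        StrictBound (mass w E) β (mass w (R.upper p))) :
    ∃ α' : ℝ, 0 < α' ∧ α' < 1 ∧ ∀ R : Rectangle n,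
      StrictBound (mass w (R.lower p ∩ {z | avg w (R.upper p) < ENNReal.ofReal (α' * w z)}))
        β (mass w (R.upper p)) := by
  obtain ⟨N, hN⟩ := measure_lower_le_of_small (n := n) (p := p) (f := f) hα
    (b := ENNReal.ofReal β)
  have hD : ∀ R : Rectangle n, volume.withDensity f (R.lower p)
      ≤ ENNReal.ofReal (N * β) * volume.withDensity f (R.upper p) := by
    intro R
    rw [ENNReal.ofReal_mul (Nat.cast_nonneg N), ENNReal.ofReal_natCast]
    refine hN R fun E hE hER hvol => ?_
    rw [← mass_eq hfw, ← mass_eq hfw]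
    exact (h R E hE hER (by rwa [volume_lower])).le
  set α' := α / (2 * (N * β + 1)) with hα'
  have hα'0 : 0 < α' := by positivity
  have hα'D : α' * (N * β) < α := by
    rw [hα', div_mul_eq_mul_div, div_lt_iff₀ (by positivity)]
    have : 0 ≤ N * β := by positivity
    nlinarith
  refine ⟨α', hα'0, ?_, fun R => ?_⟩
  · rw [hα', div_lt_one (by positivity)]
    have : 0 ≤ N * β := by positivity
    linarith
  rw [mass_superlevel_eq hfw hα'0.le, avg_upper_eq hfw]
  have hVL := halfVolume_pos (n := n) (p := p) R.L_pos
  have hVt := halfVolume_ne_top (n := n) (p := p) R.L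
  rcases eq_or_ne (volume.withDensity f (R.upper p)) 0 with h0 | h0
  · have h1 : volume.withDensity f (R.lower p) = 0 :=
      nonpos_iff_eq_zero.1 ((hD R).trans_eq (mul_eq_zero_of_right _ h0))
    exact Or.inr ⟨measure_mono_null inter_subset_left h1, by rw [mass_eq hfw, h0]⟩
  set A := volume.withDensity f (R.upper p) / halfVolume n p R.L
  have hA0 : A ≠ 0 := (ENNReal.div_pos h0 hVt).ne'
  have hAtop : A ≠ ∞ := ENNReal.div_ne_top (by rw [← mass_eq hfw]; exact hfin R) hVL.ne'
  have hup : volume.withDensity f (R.upper p) = A * halfVolume n p R.L :=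
    (ENNReal.div_mul_cancel hVL.ne' hVt).symm
  set E := R.lower p ∩ {z | A < ENNReal.ofReal α' * f z}
  have hE : MeasurableSet E :=
    (measurableSet_lower R).inter (measurableSet_lt measurable_const (hf.const_mul _))
  rw [← mass_eq hfw]
  refine h R E hE inter_subset_left ?_
  rw [volume_lower]
  have h1 : A * volume E ≤ A * (ENNReal.ofReal (α' * (N * β)) * halfVolume n p R.L) := by
    calc A * volume E = ∫⁻ _ in E, A := (setLIntegral_const _ _).symm
      _ ≤ ∫⁻ z in E, ENNReal.ofReal α' * f z := setLIntegral_mono' hE fun z hz => le_of_lt hz.2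
      _ = ENNReal.ofReal α' * volume.withDensity f E := by
          rw [lintegral_const_mul _ hf, withDensity_apply _ hE]
      _ ≤ ENNReal.ofReal α' * (ENNReal.ofReal (N * β) * volume.withDensity f (R.upper p)) := by
          gcongr
          exact (measure_mono inter_subset_left).trans (hD R)
      _ = _ := by rw [hup, ENNReal.ofReal_mul hα'0.le]; ring
  refine ((ENNReal.mul_le_mul_iff_right hA0 hAtop).1 h1).trans_lt ?_
  exact ENNReal.mul_lt_mul_left hVL.ne' hVt ((ENNReal.ofReal_lt_ofReal_iff hα).2 hα'D)

theorem lintegral_maximalPlus_le_of_reverseHolder (hp : 1 ≤ p) (hw : IsWeight w)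
    (hf : Measurable f) (hfw : (fun z => ENNReal.ofReal (w z)) =ᵐ[volume] f) {q : ℝ} (hq : 1 < q)
    (h : MemRHPlus p q w) :
    ∃ C : ℝ≥0, ∀ R : Rectangle n,
      ∫⁻ z in R.lower p, maximalPlus p ((R.lower p).indicator w) z ≤ C * mass w (R.upper p) := by
  have hq0 : 0 < q := by linarith
  obtain ⟨C, hCtop, hC⟩ := (memRHPlus_iff hfw hq0).1 h
  obtain ⟨C', hC'top, hC'⟩ :=
    exists_lintegral_forwardMaximal_le (n := n) hp hf (δ := q - 1) (by linarith) hCtop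
  refine ⟨C'.toNNReal, fun R => ?_⟩
  rw [ENNReal.coe_toNNReal hC'top, mass_eq hfw,
    lintegral_congr (fun z => maximalPlus_eq hw hfw _ (measurableSet_lower R) z)]
  rcases eq_or_ne (volume.withDensity f (R.upper p)) 0 with h0 | h0
  · have h1 : ∫⁻ z in R.lower p, f z ^ q = 0 := by
      refine nonpos_iff_eq_zero.1 ((hC R).trans_eq ?_)
      rw [h0, ENNReal.zero_div, ENNReal.zero_rpow_of_pos hq0, mul_zero, zero_mul]
    rw [setLIntegral_rpow_eq_zero hq0 hf (measurableSet_lower R)] at h1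
    have h2 : (volume.withDensity f).restrict (R.lower p) = 0 := Measure.restrict_eq_zero.2 h1
    simp [h2, forwardMaximal]
  · refine hC' R (measure_box_ne_top hw hfw _ R.L_pos.le _ _) h0
      (measure_box_ne_top hw hfw _ R.L_pos.le _ _) ?_
    rw [add_sub_cancel]
    exact hC R

theorem strictBound_superlevel_of_maximalPlus (hp : 1 ≤ p) (hw : IsWeight w)
    (hf : Measurable f) (hfw : (fun z => ENNReal.ofReal (w z)) =ᵐ[volume] f) {C : ℝ≥0}
    (h : ∀ R : Rectangle n,
      ∫⁻ z in R.lower p, maximalPlus p ((R.lower p).indicator w) z ≤ C * mass w (R.upper p))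
    {β : ℝ} (hβ : 0 < β) :
    ∃ α : ℝ, 0 < α ∧ α < 1 ∧ ∀ R : Rectangle n,
      StrictBound (mass w (R.lower p ∩ {z | avg w (R.upper p) < ENNReal.ofReal (α * w z)}))
        β (mass w (R.upper p)) := by
  have hfin : ∀ R : Rectangle n, volume.withDensity f (R.upper p) ≠ ∞ := fun R =>
    measure_box_ne_top hw hfw _ R.L_pos.le _ _
  obtain ⟨G, hG, hGm⟩ := exists_superlevel_small_of_forwardMaximal (C := C) hp hf hfin
    ENNReal.coe_ne_top fun R => by
      rw [← mass_eq hfw (R.upper p)]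
      refine le_of_eq_of_le (lintegral_congr fun z => ?_) (h R)
      exact (maximalPlus_eq hw hfw _ (measurableSet_lower R) z).symm
  obtain ⟨m, hm⟩ := exists_nat_gt (G.toReal / β)
  obtain ⟨B, hB, hBR⟩ := hGm m
  have hm0 : (0 : ℝ) < m := lt_of_le_of_lt (by positivity) hm
  refine ⟨1 / (B.toReal + 2), by positivity, ?_, fun R => ?_⟩
  · rw [div_lt_one (by positivity)]
    linarith [ENNReal.toReal_nonneg (a := B)]
  rw [mass_superlevel_eq hfw (by positivity), avg_upper_eq hfw, mass_eq hfw]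
  set A := volume.withDensity f (R.upper p) / halfVolume n p R.L
  set α := 1 / (B.toReal + 2) with hα
  refine strictBound_of_le_mul (c := G / m) ?_ ?_ (hfin R)
  · have hm' : (m : ℝ≥0∞) ≠ 0 := by exact_mod_cast hm0.ne'
    rw [ENNReal.div_eq_inv_mul, mul_assoc, ← ENNReal.div_eq_inv_mul]
    refine (ENNReal.le_div_iff_mul_le (Or.inl hm') (Or.inl (ENNReal.natCast_ne_top m))).2 ?_
    rw [mul_comm]
    refine le_trans ?_ (hBR R)
    refine mul_le_mul' le_rfl (measure_mono (inter_subset_inter_right _ fun z hz => ?_))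
    have hz : A < ENNReal.ofReal α * f z := hz
    change B * A < f z
    by_contra hcon
    have hcon : f z ≤ B * A := not_lt.1 hcon
    refine hz.not_ge ?_
    calc ENNReal.ofReal α * f z ≤ ENNReal.ofReal α * (B * A) := by gcongr
      _ = ENNReal.ofReal (α * B.toReal) * A := by
        rw [ENNReal.ofReal_mul (by positivity), ENNReal.ofReal_toReal hB, mul_assoc]
      _ ≤ 1 * A := by
        gcongr
        rw [ENNReal.ofReal_le_one, hα, one_div_mul_eq_div, div_le_one (by positivity)]
        linarith
      _ = A := one_mul A
  · have hm' : (m : ℝ≥0∞) ≠ 0 := by exact_mod_cast hm0.ne'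
    rw [ENNReal.div_lt_iff (Or.inl hm') (Or.inl (ENNReal.natCast_ne_top m)),
      ← ENNReal.ofReal_natCast, ← ENNReal.ofReal_mul hβ.le, ← ENNReal.ofReal_toReal hG]
    refine (ENNReal.ofReal_lt_ofReal_iff (by positivity)).2 ?_
    rw [div_lt_iff₀ hβ] at hm
    linarith

theorem lintegral_logPlus_le_of_reverseHolder
    (hf : Measurable f) (hw : IsWeight w)
    (hfw : (fun z => ENNReal.ofReal (w z)) =ᵐ[volume] f) {q : ℝ} (hq : 1 < q)
    (h : MemRHPlus p q w) :
    ∃ C : ℝ≥0, ∀ R : Rectangle n,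
      ∫⁻ z in R.lower p,
          ENNReal.ofReal (w z) * logPlus (ENNReal.ofReal (w z) / avg w (R.upper p))
        ≤ C * mass w (R.upper p) := by
  have hq0 : 0 < q := by linarith
  have hδ : 0 < q - 1 := by linarith
  obtain ⟨C, hCtop, hC⟩ := (memRHPlus_iff hfw hq0).1 h
  have hδ' : (ENNReal.ofReal (q - 1))⁻¹ ≠ ∞ := ENNReal.inv_ne_top.2 (by simpa using hq)
  have hCC := ENNReal.mul_ne_top hδ' hCtop
  refine ⟨((ENNReal.ofReal (q - 1))⁻¹ * C).toNNReal, fun R => ?_⟩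
  rw [ENNReal.coe_toNNReal hCC, mass_eq hfw, avg_upper_eq hfw]
  have hVL := halfVolume_pos (n := n) (p := p) R.L_pos
  have hVt := halfVolume_ne_top (n := n) (p := p) R.L
  have hfin : volume.withDensity f (R.upper p) ≠ ∞ := measure_box_ne_top hw hfw _ R.L_pos.le _ _
  have hRH := hC R
  set A := volume.withDensity f (R.upper p) / halfVolume n p R.L with hA
  have hup : volume.withDensity f (R.upper p) = A * halfVolume n p R.L :=
    (ENNReal.div_mul_cancel hVL.ne' hVt).symm
  have hAtop : A ≠ ∞ := ENNReal.div_ne_top hfin hVL.ne'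
  have hcongr : ∫⁻ z in R.lower p, ENNReal.ofReal (w z) * logPlus (ENNReal.ofReal (w z) / A)
      = ∫⁻ z in R.lower p, f z * logPlus (f z / A) := by
    refine lintegral_congr_ae (ae_restrict_of_ae ?_)
    filter_upwards [hfw] with z hz
    rw [hz]
  rw [hcongr]
  rcases eq_or_ne A 0 with hA0 | hA0
  · have h1 : ∫⁻ z in R.lower p, f z ^ q = 0 := by
      refine nonpos_iff_eq_zero.1 (hRH.trans_eq ?_)
      rw [hA0, ENNReal.zero_rpow_of_pos hq0, mul_zero, zero_mul]
    rw [lintegral_eq_zero_iff (hf.pow_const q)] at h1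
    refine le_of_eq_of_le ?_ zero_le
    rw [← lintegral_zero (μ := volume.restrict (R.lower p))]
    refine lintegral_congr_ae ?_
    filter_upwards [h1] with z hz
    have : f z = 0 := by
      simpa [ENNReal.rpow_eq_zero_iff, hq0, hq0.le, not_lt.2 hq0.le] using hz
    simp [this]
  have hAδ0 : A ^ (q - 1) ≠ 0 := by simp [ENNReal.rpow_eq_zero_iff, hA0, hAtop]
  have hAδt : A ^ (q - 1) ≠ ∞ := ENNReal.rpow_ne_top_of_nonneg hδ.le hAtop
  have hAq : A ^ q = A ^ (q - 1) * A := by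
    conv_lhs => rw [show q = (q - 1) + 1 by ring]
    rw [ENNReal.rpow_add_of_nonneg _ _ hδ.le zero_le_one, ENNReal.rpow_one]
  calc ∫⁻ z in R.lower p, f z * logPlus (f z / A)
      ≤ ∫⁻ z in R.lower p, (ENNReal.ofReal (q - 1))⁻¹ * (A ^ (q - 1))⁻¹ * f z ^ q := by
        refine lintegral_mono fun z => ?_
        calc f z * logPlus (f z / A)
            ≤ f z * ((ENNReal.ofReal (q - 1))⁻¹ * (f z / A) ^ (q - 1)) := by
              gcongr
              exact logPlus_le_rpow hδ _
          _ = (ENNReal.ofReal (q - 1))⁻¹ * (A ^ (q - 1))⁻¹ * (f z ^ (1 : ℝ) * f z ^ (q - 1)) := by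
              rw [ENNReal.div_rpow_of_nonneg _ _ hδ.le, ENNReal.div_eq_inv_mul, ENNReal.rpow_one]
              ring
          _ = _ := by rw [← ENNReal.rpow_add_of_nonneg _ _ zero_le_one hδ.le, add_sub_cancel]
    _ = (ENNReal.ofReal (q - 1))⁻¹ * (A ^ (q - 1))⁻¹ * ∫⁻ z in R.lower p, f z ^ q :=
        lintegral_const_mul _ (hf.pow_const q)
    _ ≤ (ENNReal.ofReal (q - 1))⁻¹ * (A ^ (q - 1))⁻¹ * (C * A ^ q * halfVolume n p R.L) := by
        gcongr
    _ = (ENNReal.ofReal (q - 1))⁻¹ * C * ((A ^ (q - 1))⁻¹ * A ^ (q - 1)) *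
          (A * halfVolume n p R.L) := by rw [hAq]; ring
    _ = _ := by rw [ENNReal.inv_mul_cancel hAδ0 hAδt, mul_one, ← hup]

theorem strictBound_superlevel_of_logPlus (hf : Measurable f) (hw : IsWeight w)
    (hfw : (fun z => ENNReal.ofReal (w z)) =ᵐ[volume] f) {C : ℝ≥0}
    (h : ∀ R : Rectangle n,
      ∫⁻ z in R.lower p,
          ENNReal.ofReal (w z) * logPlus (ENNReal.ofReal (w z) / avg w (R.upper p))
        ≤ C * mass w (R.upper p))
    {β : ℝ} (hβ : 0 < β) :
    ∃ α : ℝ, 0 < α ∧ α < 1 ∧ ∀ R : Rectangle n,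
      StrictBound (mass w (R.lower p ∩ {z | avg w (R.upper p) < ENNReal.ofReal (α * w z)}))
        β (mass w (R.upper p)) := by
  set T := (C + 1) / β with hT
  have hT0 : 0 < T := by positivity
  refine ⟨Real.exp (-T), Real.exp_pos _, by simpa using hT0, fun R => ?_⟩
  have hR := h R
  rw [mass_superlevel_eq hfw (Real.exp_pos _).le]
  have hfin : mass w (R.upper p) ≠ ∞ := by
    rw [mass_eq hfw]
    exact measure_box_ne_top hw hfw _ R.L_pos.le _ _
  set A := avg w (R.upper p)
  set b := mass w (R.upper p)
  set S := R.lower p ∩ {z | A < ENNReal.ofReal (Real.exp (-T)) * f z}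
  have hS : MeasurableSet S :=
    (measurableSet_lower R).inter (measurableSet_lt measurable_const (hf.const_mul _))
  have hlog : logPlus (ENNReal.ofReal (Real.exp T)) = ENNReal.ofReal T := by
    rw [logPlus, ENNReal.log_ofReal_of_pos (Real.exp_pos T), Real.log_exp,
      EReal.toENNReal_of_ne_top (by simp), EReal.toReal_coe]
  have hexp : ENNReal.ofReal (Real.exp T) * ENNReal.ofReal (Real.exp (-T)) = 1 := by
    rw [← ENNReal.ofReal_mul (Real.exp_pos T).le, ← Real.exp_add, add_neg_cancel, Real.exp_zero,
      ENNReal.ofReal_one]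
  have hmain : ENNReal.ofReal T * volume.withDensity f S ≤ C * b := by
    refine le_trans ?_ hR
    calc ENNReal.ofReal T * volume.withDensity f S = ∫⁻ z in S, ENNReal.ofReal T * f z := by
          rw [lintegral_const_mul _ hf, withDensity_apply _ hS]
      _ ≤ ∫⁻ z in S, f z * logPlus (f z / A) := by
          refine setLIntegral_mono' hS fun z hz => ?_
          have hz : A < ENNReal.ofReal (Real.exp (-T)) * f z := hz.2
          rw [mul_comm, ← hlog]
          gcongr
          refine logPlus_mono ?_
          have hA0 : ENNReal.ofReal (Real.exp T) * A ≤ f z := by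
            calc ENNReal.ofReal (Real.exp T) * A
                ≤ ENNReal.ofReal (Real.exp T) * (ENNReal.ofReal (Real.exp (-T)) * f z) := by gcongr
              _ = f z := by rw [← mul_assoc, hexp, one_mul]
          refine (ENNReal.le_div_iff_mul_le (Or.inr ?_) (Or.inl hz.ne_top)).2 hA0
          rintro h0
          simp [h0] at hz
      _ = ∫⁻ z in S, ENNReal.ofReal (w z) * logPlus (ENNReal.ofReal (w z) / A) := by
          refine lintegral_congr_ae (ae_restrict_of_ae ?_)
          filter_upwards [hfw] with z hz
          rw [hz]
      _ ≤ _ := lintegral_mono_set inter_subset_left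
  have hT0' : ENNReal.ofReal T ≠ 0 := by simpa using hT0
  refine strictBound_of_le_mul (c := C / ENNReal.ofReal T) ?_ ?_ hfin
  · rw [ENNReal.div_eq_inv_mul, mul_assoc]
    rw [← ENNReal.div_eq_inv_mul]
    exact (ENNReal.le_div_iff_mul_le (Or.inl hT0') (Or.inl ENNReal.ofReal_ne_top)).2
      (by rwa [mul_comm])
  · rw [ENNReal.div_lt_iff (Or.inl hT0') (Or.inl ENNReal.ofReal_ne_top),
      ← ENNReal.ofReal_mul hβ.le, hT, mul_div_cancel₀ _ hβ.ne', ← ENNReal.ofReal_coe_nnreal,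
      ENNReal.ofReal_lt_ofReal_iff (by positivity)]
    linarith

end Equivalences

end Parabolic

open Parabolic in
/-- Characterizations of `⋃_{q > 1} RH⁺_q`. Masses, averages and integrals take values in `[0, ∞]`,
where division obeys `0 / 0 = 0` and `a / 0 = ∞` for `a > 0`. -/
theorem mainTheorem1 (n : ℕ) (p : ℝ) (hp : 1 ≤ p) (w : SpaceTime n → ℝ) (hw : IsWeight w) :
    List.TFAE [
      -- (i)
      ∃ q : ℝ, 1 < q ∧ MemRHPlus p q w,
      -- (ii)
      ∃ (C : ℝ≥0) (δ : ℝ), 0 < C ∧ 0 < δ ∧ ∀ (R : Rectangle n) (E : Set (SpaceTime n)),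
        MeasurableSet E → E ⊆ R.lower p →
          mass w E / mass w (R.upper p) ≤ C * (volume E / volume (R.lower p)) ^ δ,
      -- (iii)
      ∀ β : ℝ, 0 < β → ∃ α : ℝ, 0 < α ∧ α < 1 ∧
        ∀ (R : Rectangle n) (E : Set (SpaceTime n)), MeasurableSet E → E ⊆ R.lower p →
          volume E < ENNReal.ofReal α * volume (R.lower p) →
            StrictBound (mass w E) β (mass w (R.upper p)),
      -- (iv)
      ∃ α β : ℝ, 0 < α ∧ α < 1 ∧ 0 < β ∧ β < 1 / 2 ^ ((n : ℝ) + p) ∧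
        ∀ (R : Rectangle n) (E : Set (SpaceTime n)), MeasurableSet E → E ⊆ R.lower p →
          volume E < ENNReal.ofReal α * volume (R.lower p) →
            StrictBound (mass w E) β (mass w (R.upper p)),
      -- (v)
      ∃ α β : ℝ, 0 < α ∧ α < 1 ∧ 0 < β ∧ β < 1 / 2 ^ ((n : ℝ) + p) ∧
        ∀ R : Rectangle n,
          StrictBound
            (mass w (R.lower p ∩ {z | avg w (R.upper p) < ENNReal.ofReal (α * w z)}))
            β (mass w (R.upper p)),
      -- (vi)
      ∃ C : ℝ≥0, ∀ R : Rectangle n,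
        ∫⁻ z in R.lower p, maximalPlus p ((R.lower p).indicator w) z
          ≤ C * mass w (R.upper p),
      -- (vii)
      ∃ C : ℝ≥0, ∀ R : Rectangle n,
        ∫⁻ z in R.lower p,
            ENNReal.ofReal (w z) * logPlus (ENNReal.ofReal (w z) / avg w (R.upper p))
          ≤ C * mass w (R.upper p)] := by
  obtain ⟨f, hf, hftop, hfw⟩ := exists_measurable_density hw
  have hfin : ∀ R : Rectangle n, volume.withDensity f (R.upper p) ≠ ∞ := fun R =>
    measure_box_ne_top hw hfw _ R.L_pos.le _ _
  have hfin' : ∀ R : Rectangle n, mass w (R.upper p) ≠ ∞ := fun R => by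
    rw [mass_eq hfw]
    exact hfin R
  have hβ₀ : (0 : ℝ) < 1 / 2 ^ ((n : ℝ) + p) := by positivity
  have hβ₁ : (0 : ℝ) < 1 / 2 ^ ((n : ℝ) + p) / 2 := half_pos hβ₀
  tfae_have 1 → 2
  | ⟨q, hq, h⟩ => div_measure_le_of_reverseHolder hf hfw hq h
  tfae_have 2 → 3
  | ⟨C, δ, hC, hδ, h⟩ => fun β hβ => strictBound_of_div_le hC hδ hfin' h hβ
  tfae_have 3 → 4
  | h => by
    obtain ⟨α, hα, hα1, hα'⟩ := h _ hβ₁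
    exact ⟨α, _, hα, hα1, hβ₁, half_lt_self hβ₀, hα'⟩
  tfae_have 4 → 5
  | ⟨α, β, hα, hα1, hβ, hβ', h⟩ => by
    obtain ⟨α', hα', hα'1, h'⟩ := strictBound_superlevel_of_small hf hfw hfin' hα hα1 hβ h
    exact ⟨α', β, hα', hα'1, hβ, hβ', h'⟩
  tfae_have 5 → 1
  | ⟨α, β, hα, hα1, hβ, hβ', h⟩ => by
    obtain ⟨q, C, hq, hC, hRH⟩ := exists_reverseHolder_of_superlevel hp hf hftop hfin hα hβ'
      fun R => by
        have := (h R).le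
        rwa [mass_superlevel_eq hfw hα.le, avg_upper_eq hfw, mass_eq hfw] at this
    exact ⟨q, hq, (memRHPlus_iff hfw (by linarith)).2 ⟨C, hC, hRH⟩⟩
  tfae_have 1 → 6
  | ⟨q, hq, h⟩ => lintegral_maximalPlus_le_of_reverseHolder hp hw hf hfw hq h
  tfae_have 6 → 5
  | ⟨C, h⟩ => by
    obtain ⟨α, hα, hα1, h'⟩ := strictBound_superlevel_of_maximalPlus hp hw hf hfw h hβ₁
    exact ⟨α, _, hα, hα1, hβ₁, half_lt_self hβ₀, h'⟩
  tfae_have 1 → 7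
  | ⟨q, hq, h⟩ => lintegral_logPlus_le_of_reverseHolder hf hw hfw hq h
  tfae_have 7 → 5
  | ⟨C, h⟩ => by
    obtain ⟨α, hα, hα1, h'⟩ := strictBound_superlevel_of_logPlus hf hw hfw h hβ₁
    exact ⟨α, _, hα, hα1, hβ₁, half_lt_self hβ₀, h'⟩
  tfae_finish
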